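/- **Setting.** Fix $d\in\mathbb N$ and let $L=2^d$. Let $\kappa\in\mathbb N$ denote the security parameter. For every $\kappa$ let $\mathcal V=\mathcal V_\kappa$ and $\mathcal R=\mathcal R_\kappa$ be finite sets (of values and of masking values) with $|\mathcal R|\ge 2^\kappa$, whose elements are written as bit strings in such a way that $(v,r)\mapsto v\|r$ is injective on $\mathcal V\times\mathcal R$. Let $\mathsf H:\{0,1\}^*\to\{0,1\}^\kappa$ be a random oracle, i.e. its values are independent and uniform on $\{0,1\}^\kappa$. **Construction.** Consider the complete binary tree of depth $d$. Its $j$-th node at height $n$ ($0\le n\le d$, $0\le j<2^{d-n}$, counted from the left) has as identifier $b\in\{0,1,*\}^d$ the $(d-n)$-bit binary representation of $j$ followed by $n$ stars, written as a bit string with two bits per symbol; $\operatorname{leaf}(i)$ is the identifier of the $i$-th leaf, $i\in[L]$, that is, the $d$-bit binary representation of $i-1$. Given $\mathbf v\in\mathcal V^L$ and $\mathbf r\in\mathcal R^L$, put $h_{\operatorname{leaf}(i)}=\mathsf H(\operatorname{leaf}(i)\|v_i\|r_i)$ for the leaves and $h_b=\mathsf H(b\|h_{b_L}\|h_{b_R})$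 for an interior node $b$ with left child $b_L$ and right child $b_R$. * $\mathsf{Commit}(\mathbf v,\mathbf r)$ is the hash of the root. * $\mathsf{Open}(\mathbf v,\mathbf r,i)$ is the list of the $d$ hashes of the siblings of the nodes on the path from leaf $i$ to the root. * $\mathsf{Verify}(C,i,v,r,w)$ starts from $\mathsf H(\operatorname{leaf}(i)\|v\|r)$, recomputes the hashes along the path from leaf $i$ to the root with the sibling hashes $w$, and outputs $1$ iff the result is $C$. An adversary is any probabilistic strategy (possibly computationally unbounded) with adaptive access to $\mathsf H$; it is *query-bounded* if its number of queries (to $\mathsf H$ and for openings) is at most $p(\kappa)$ for some polynomial $p$. In particular, every probabilistic polynomial-time adversary is query-bounded. A function $f$ is negligible if for every $c>0$ there is an $n_0$ with $f(n)<1/n^c$ for all $n\ge n_0$. **Lemma.** The construction is a vector commitment scheme that, in the random oracle model, satisfies: * **Correctness.** For every $\mathsf H$, all $\mathbf v\in\mathcal V^L$, $\mathbf r\in\mathcal R^L$ and $i\in[L]$: $\mathsf{Verify}(\mathsf{Commit}(\mathbf v,\mathbf r),i,v_i,r_i,\mathsf{Open}(\mathbf v,\mathbf r,i))=1$. * **Binding.**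 For every query-bounded adversary, the probability that it outputs $(\mathbf v,\mathbf v',\mathbf r,\mathbf r')$ with $(\mathbf v,\mathbf r)\ne(\mathbf v',\mathbf r')$ and $\mathsf{Commit}(\mathbf v,\mathbf r)=\mathsf{Commit}(\mathbf v',\mathbf r')$ is negligible in $\kappa$. More precisely, for every $\kappa$ it is at most $Q^2/2^\kappa$ with $Q=q+2(2L-1)$, if the adversary makes at most $q$ queries to $\mathsf H$. * **Position binding.** For every query-bounded adversary, the probability that it outputs $(C,i,v,v',r,r',w,w')$ with $(v,r)\ne(v',r')$ and $\mathsf{Verify}(C,i,v,r,w)=\mathsf{Verify}(C,i,v',r',w')=1$ is negligible in $\kappa$. More precisely, for every $\kappa$ it is at most $Q^2/2^\kappa$ with $Q=q+2(d+1)$, if the adversary makes at most $q$ queries to $\mathsf H$. * **Hiding.** Consider the following game. The adversary chooses $(\mathbf v^{(0)},\mathbf v^{(1)})$. The challenger draws a uniform bit $b$ and a uniform $\mathbf r\in\mathcal R^L$, independent of each other and of $\mathsf H$, and gives $C=\mathsf{Commit}(\mathbf v^{(b)},\mathbf r)$ to the adversary. The adversary may adaptively ask for openings $(r_i,\mathsf{Open}(\mathbf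 v^{(b)},\mathbf r,i))$ at indices $i$ with $v^{(0)}_i=v^{(1)}_i$. Finally it outputs a guess $\hat b\in\{0,1\}$. Throughout, it may query $\mathsf H$. For every query-bounded adversary, $|\Pr[\hat b=b]-\tfrac12|$ is negligible in $\kappa$. More precisely, for every $\kappa$ it is at most $q/2^\kappa$, if the adversary makes at most $q$ queries to $\mathsf H$. -/

import Mathlib

open scoped ENNReal

namespace SaltedMerkle

/-! ### Random oracle and adversaries -/

/-- Hash values: bit strings of length `κ`. -/
abbrev Hash (κ : ℕ) : Type := Fin κ → Bool

/-- Functions `{0,1}* → {0,1}^κ`. -/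
abbrev Oracle (κ : ℕ) : Type := List Bool → Hash κ

/-- The law of the random oracle: all values `H x`, for `x` in `{0,1}*`, are independent and
uniform on `{0,1}^κ`. -/
noncomputable def oracleLaw (κ : ℕ) : MeasureTheory.Measure (Oracle κ) :=
  MeasureTheory.Measure.infinitePi
    (fun _ : List Bool => (PMF.uniformOfFintype (Hash κ)).toMeasure)

/-- The probability of the event `E H x`, where `x` is drawn from `D` and, independently,
`H` is a random oracle. -/
noncomputable def romProb {κ : ℕ} {α : Type} (D : PMF α) (E : Oracle κ → α → Prop) : ℝ :=
  (∑' x, D x * oracleLaw κ {H | E H x}).toReal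

/-- Deterministic interactive strategies that adaptively ask finitely many questions `q : Q`,
get answers in `Ans q`, and finally output an element of `α`. No bound is put on the internal
computation. A probabilistic strategy is a `PMF` on deterministic ones. -/
inductive Interaction (Q : Type) (Ans : Q → Type) (α : Type) : Type
  | done (a : α) : Interaction Q Ans α
  | ask (q : Q) (next : Ans q → Interaction Q Ans α) : Interaction Q Ans α

namespace Interaction

variable {Q : Type} {Ans : Q → Type} {α : Type}

/-- The output, when every question `q` is answered by `answer q`. -/
def run (answer : ∀ q, Ans q) : Interaction Q Ans α → α
  | done a => a
  | ask q next => (next (answer q)).run answer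

/-- The list of the questions that are asked, when every `q` is answered by `answer q`. -/
def asked (answer : ∀ q, Ans q) : Interaction Q Ans α → List Q
  | done _ => []
  | ask q next => q :: (next (answer q)).asked answer

end Interaction

/-- Strategies with access to the random oracle. -/
abbrev OracleStrategy (κ : ℕ) (α : Type) : Type :=
  Interaction (List Bool) (fun _ => Hash κ) α

/-- `f` is negligible: it is eventually smaller than every inverse power. -/
def Negligible (f : ℕ → ℝ) : Prop :=
  ∀ c : ℝ, 0 < c → ∃ n₀ : ℕ, ∀ n : ℕ, n₀ ≤ n → f n < 1 / (n : ℝ) ^ c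

/-! ### Vector commitments in the random oracle model -/

/-- The three (deterministic) algorithms of a vector commitment scheme for vectors of length `L`
with values in `V` and masking values in `R`; all have access to the oracle. The index set
`{1, ..., L}` is `Fin L`, numbered from `0`. -/
structure VCScheme (κ L : ℕ) (V R : Type) where
  /-- commitments -/
  Com : Type
  /-- witnesses -/
  Wit : Type
  commit : Oracle κ → (Fin L → V) → (Fin L → R) → Com
  openAt : Oracle κ → (Fin L → V) → (Fin L → R) → Fin L → Wit
  verify : Oracle κ → Com → Fin L → V → R → Wit → Bool

namespace VCScheme

variable {κ L : ℕ} {V R : Type}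

/-- Honest openings verify. -/
def Correct (S : VCScheme κ L V R) : Prop :=
  ∀ (H : Oracle κ) (v : Fin L → V) (r : Fin L → R) (i : Fin L),
    S.verify H (S.commit H v r) i (v i) (r i) (S.openAt H v r i) = true

/-! #### Binding -/

/-- Strategies that output `(v, v', r, r')`. -/
abbrev BindingStrategy (_S : VCScheme κ L V R) : Type :=
  OracleStrategy κ ((Fin L → V) × (Fin L → V) × (Fin L → R) × (Fin L → R))

def BindingWin (S : VCScheme κ L V R) (H : Oracle κ) (a : S.BindingStrategy) : Prop :=
  match a.run H with
  | (v, v', r, r') => (v ≠ v' ∨ r ≠ r') ∧ S.commit H v r = S.commit H v' r'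

/-- The probability that the adversary `A` wins the binding game. -/
noncomputable def bindingProb (S : VCScheme κ L V R) (A : PMF S.BindingStrategy) : ℝ :=
  romProb A S.BindingWin

/-! #### Position binding -/

/-- Strategies that output `(C, i, v, v', r, r', w, w')`. -/
abbrev PositionStrategy (S : VCScheme κ L V R) : Type :=
  OracleStrategy κ (S.Com × Fin L × V × V × R × R × S.Wit × S.Wit)

def PositionWin (S : VCScheme κ L V R) (H : Oracle κ) (a : S.PositionStrategy) : Prop :=
  match a.run H with
  | (C, i, v, v', r, r', w, w') =>
    (v ≠ v' ∨ r ≠ r') ∧ S.verify H C i v r w = true ∧ S.verify H C i v' r' w' = true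

/-- The probability that the adversary `A` wins the position binding game. -/
noncomputable def positionProb (S : VCScheme κ L V R) (A : PMF S.PositionStrategy) : ℝ :=
  romProb A S.PositionWin

/-! #### Hiding -/

/-- What the adversary can ask after it has received the commitment: oracle queries (left)
and opening queries (right). An opening query that is not allowed is answered by `none`. -/
abbrev GuessAnswer (S : VCScheme κ L V R) : List Bool ⊕ Fin L → Type
  | .inl _ => Hash κ
  | .inr _ => Option (R × S.Wit)

/-- The second phase of the adversary: it makes oracle queries and opening queries and then
outputs a guess. -/
abbrev GuessStrategy (S : VCScheme κ L V R) : Type :=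
  Interaction (List Bool ⊕ Fin L) S.GuessAnswer Bool

/-- The adversary in the hiding game: with access to the oracle it chooses the two vectors
`vs false` and `vs true`, together with its continuation, which starts from the commitment. -/
abbrev HidingStrategy (S : VCScheme κ L V R) : Type :=
  OracleStrategy κ ((Bool → Fin L → V) × (S.Com → S.GuessStrategy))

open Classical in
/-- The answers of the challenger that has committed to `vs b` with randomness `r`: openings
are given exactly at the indices where the two vectors agree. -/
noncomputable def guessAnswer (S : VCScheme κ L V R) (H : Oracle κ) (vs : Bool → Fin L → V)
    (b : Bool) (r : Fin L → R) : ∀ q, S.GuessAnswer q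
  | .inl x => H x
  | .inr i =>
    if vs false i = vs true i then some (r i, S.openAt H (vs b) r i) else none

/-- The adversary's guess, when the challenger uses the bit `b` and randomness `r`. -/
noncomputable def hidingGuess (S : VCScheme κ L V R) (H : Oracle κ) (a : S.HidingStrategy)
    (b : Bool) (r : Fin L → R) : Bool :=
  match a.run H with
  | (vs, k) => (k (S.commit H (vs b) r)).run (S.guessAnswer H vs b r)

/-- The questions that the adversary asks in the second phase. -/
noncomputable def guessAsked (S : VCScheme κ L V R) (H : Oracle κ) (a : S.HidingStrategy)
    (b : Bool) (r : Fin L → R) : List (List Bool ⊕ Fin L) :=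
  match a.run H with
  | (vs, k) => (k (S.commit H (vs b) r)).asked (S.guessAnswer H vs b r)

/-- The number of all queries (to the oracle and for openings) of the adversary. -/
noncomputable def hidingQueries (S : VCScheme κ L V R) (H : Oracle κ) (a : S.HidingStrategy)
    (b : Bool) (r : Fin L → R) : ℕ :=
  (a.asked H).length + (S.guessAsked H a b r).length

/-- The number of oracle queries of the adversary, in both phases together. -/
noncomputable def hidingOracleQueries (S : VCScheme κ L V R) (H : Oracle κ)
    (a : S.HidingStrategy) (b : Bool) (r : Fin L → R) : ℕ :=
  (a.asked H).length + (S.guessAsked H a b r).countP Sum.isLeft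

/-- The probability that the adversary `A` guesses the bit `b`, where the bit and the
randomness `r` are uniform and independent of each other, of `A` and of the oracle. -/
noncomputable def hidingProb [Fintype R] [Nonempty R] (S : VCScheme κ L V R)
    (A : PMF S.HidingStrategy) : ℝ :=
  romProb
    (A.bind fun a => (PMF.uniformOfFintype Bool).bind fun b =>
      (PMF.uniformOfFintype (Fin L → R)).bind fun r => PMF.pure (a, b, r))
    (fun H (x : S.HidingStrategy × Bool × (Fin L → R)) =>
      S.hidingGuess H x.1 x.2.1 x.2.2 = x.2.1)

end VCScheme

/-- A family of vector commitment schemes, indexed by the security parameter `κ`, is correct,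
binding, position binding and hiding in the random oracle model. The adversaries are all
(possibly computationally unbounded) probabilistic strategies whose number of queries is bounded
by a polynomial in `κ`; this includes all probabilistic polynomial-time adversaries. -/
structure IsGoodVC {L : ℕ} {V R : ℕ → Type} [∀ κ, Fintype (R κ)] [∀ κ, Nonempty (R κ)]
    (S : ∀ κ, VCScheme κ L (V κ) (R κ)) : Prop where
  isCorrect : ∀ κ, (S κ).Correct
  isBinding : ∀ A : ∀ κ, PMF (S κ).BindingStrategy,
    (∃ p : Polynomial ℕ, ∀ κ, ∀ a ∈ (A κ).support, ∀ H : Oracle κ,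
      (a.asked H).length ≤ p.eval κ) →
    Negligible fun κ => (S κ).bindingProb (A κ)
  isPositionBinding : ∀ A : ∀ κ, PMF (S κ).PositionStrategy,
    (∃ p : Polynomial ℕ, ∀ κ, ∀ a ∈ (A κ).support, ∀ H : Oracle κ,
      (a.asked H).length ≤ p.eval κ) →
    Negligible fun κ => (S κ).positionProb (A κ)
  isHiding : ∀ A : ∀ κ, PMF (S κ).HidingStrategy,
    (∃ p : Polynomial ℕ, ∀ κ, ∀ a ∈ (A κ).support, ∀ (H : Oracle κ) (b : Bool)
      (r : Fin L → R κ), (S κ).hidingQueries H a b r ≤ p.eval κ) →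
    Negligible fun κ => |(S κ).hidingProb (A κ) - 1 / 2|

/-! ### The Merkle tree with a random salt at each leaf -/

/-- The identifier in `{0,1,*}^d` of the `j`-th node (counted from `0` on the left) at height `n`
of a complete binary tree of depth `d`: the `(d - n)`-bit binary representation of `j`, most
significant bit first, followed by `n` stars; `none` is the star. -/
def nodeId (d n j : ℕ) : List (Option Bool) :=
  List.ofFn fun t : Fin d =>
    if d - 1 - t < n then none else some (j.testBit (d - 1 - t - n))

/-- Two bits for each symbol of an identifier. -/
def symbolBits : Option Bool → List Bool
  | none => [true, true]
  | some b => [false, b]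

/-- The identifier of a node as a bit string. -/
def nodeBits (d n j : ℕ) : List Bool := (nodeId d n j).flatMap symbolBits

section Tree

variable {κ d : ℕ}

/-- The hash of the interior node with children hashes `h₀` (left) and `h₁` (right). -/
def interiorHash (H : Oracle κ) (d n j : ℕ) (h₀ h₁ : Hash κ) : Hash κ :=
  H (nodeBits d n j ++ List.ofFn h₀ ++ List.ofFn h₁)

variable {V R : Type} (encV : V → List Bool) (encR : R → List Bool)

/-- The hash `H (leaf j ‖ v ‖ r)` of a leaf. -/
def leafHash (H : Oracle κ) (d j : ℕ) (v : V) (r : R) : Hash κ :=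
  H (nodeBits d 0 j ++ encV v ++ encR r)

/-- The hash of the `j`-th node at height `n` in the tree with leaf hashes `leaf`. -/
def nodeHash (H : Oracle κ) (d : ℕ) (leaf : ℕ → Hash κ) : ℕ → ℕ → Hash κ
  | 0, j => leaf j
  | n + 1, j =>
    interiorHash H d (n + 1) j
      (nodeHash H d leaf n (2 * j)) (nodeHash H d leaf n (2 * j + 1))

/-- The leaf hashes of the tree for `(v, r)`; the value for `2 ^ d ≤ j` is never used. -/
def leafHashes (H : Oracle κ) (v : Fin (2 ^ d) → V) (r : Fin (2 ^ d) → R) (j : ℕ) : Hash κ :=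
  if h : j < 2 ^ d then leafHash encV encR H d j (v ⟨j, h⟩) (r ⟨j, h⟩) else fun _ => false

/-- The sibling of the `j`-th node at some height. -/
def sibling (j : ℕ) : ℕ := if j % 2 = 0 then j + 1 else j - 1

/-- The hash at height `n` on the path from leaf `i` to the root, recomputed from the leaf hash
`h` and the sibling hashes `w`. -/
def pathHash (H : Oracle κ) (i : ℕ) (h : Hash κ) (w : Fin d → Hash κ) : ∀ n : ℕ, n ≤ d → Hash κ
  | 0, _ => h
  | n + 1, hn =>
    if i / 2 ^ n % 2 = 0 then
      interiorHash H d (n + 1) (i / 2 ^ (n + 1))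
        (pathHash H i h w n (Nat.le_of_succ_le hn)) (w ⟨n, hn⟩)
    else
      interiorHash H d (n + 1) (i / 2 ^ (n + 1))
        (w ⟨n, hn⟩) (pathHash H i h w n (Nat.le_of_succ_le hn))

end Tree

/-- The salted Merkle tree of depth `d` as a vector commitment scheme for vectors of length
`2 ^ d`. The commitment is the root hash; the witness for index `i` consists of the hashes of
the siblings of the nodes on the path from leaf `i` to the root. -/
def merkleVC (κ d : ℕ) {V R : Type} (encV : V → List Bool) (encR : R → List Bool) :
    VCScheme κ (2 ^ d) V R where
  Com := Hash κ
  Wit := Fin d → Hash κ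
  commit H v r := nodeHash H d (leafHashes encV encR H v r) d 0
  openAt H v r i n := nodeHash H d (leafHashes encV encR H v r) n (sibling (i / 2 ^ (n : ℕ)))
  verify H C i v r w := decide (pathHash H i (leafHash encV encR H d i v r) w d le_rfl = C)

end SaltedMerkle

/-!
Binding. If two different openings lead to the same root, then the recomputations of the root meet
in a collision of the oracle. Let the adversary be followed by the recomputation of its output; if
this takes `Q` queries, the birthday bound `Q ^ 2 / 2 ^ κ` applies. It holds for adaptive queries
because the oracle can be changed at the `j`-th query, as long as that query is new, without
changing its law or the first `j` queries: all differences to an earlier answer are equally likely.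

Hiding. Permuting the points of a random oracle does not change its law. Exchanging the points
`leaf(i) ‖ v_i ‖ r_i` of the two vectors, for all `i`, turns the game with bit `b` into the game
with bit `!b`. The adversary notices the exchange only if it queries the oracle at a leaf point with
a salt `r_i` in use. To bound the probability of that, exchange `r_i` with another salt `s`: until
one of the two is queried, the adversary cannot tell which of them is in use. Since `q` queries
touch at most `q` pairs `(i, s)`, averaging over `s` gives the bound `2 * q / |R|` for the
probability that a salt in use is touched, and half of it bounds the advantage.
-/

namespace SaltedMerkle

/-! ### Countable-valued measurable functions -/

/-- `f` takes countably many values, each on a measurable set. An interaction has infinitely many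
possible transcripts, but only countably many; this notion therefore replaces measurability
into the (possibly uncountable) type of its outputs. -/
def CountablyMeasurable {Ω γ : Type*} [MeasurableSpace Ω] (f : Ω → γ) : Prop :=
  (Set.range f).Countable ∧ ∀ c, MeasurableSet (f ⁻¹' {c})

namespace CountablyMeasurable

variable {Ω γ δ : Type*} [MeasurableSpace Ω]

theorem measurableSet_preimage {f : Ω → γ} (hf : CountablyMeasurable f) (s : Set γ) :
    MeasurableSet (f ⁻¹' s) := by
  rw [← Set.preimage_inter_range, ← Set.biUnion_preimage_singleton]
  exact .biUnion (hf.1.mono Set.inter_subset_right) fun c _ => hf.2 c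

theorem const (c : γ) : CountablyMeasurable fun _ : Ω => c :=
  ⟨(Set.countable_singleton c).mono Set.range_const_subset,
    fun e => .const (c = e)⟩

theorem of_measurable [Countable γ] [MeasurableSpace γ] [MeasurableSingletonClass γ] {f : Ω → γ}
    (hf : Measurable f) : CountablyMeasurable f :=
  ⟨Set.to_countable _, fun c => hf (measurableSet_singleton c)⟩

theorem bind {f : Ω → γ} {g : γ → Ω → δ} (hf : CountablyMeasurable f)
    (hg : ∀ c, CountablyMeasurable (g c)) : CountablyMeasurable fun ω => g (f ω) ω := by
  refine ⟨(hf.1.biUnion fun c _ => (hg c).1).mono ?_, fun e => ?_⟩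
  · rintro _ ⟨ω, rfl⟩
    exact Set.mem_biUnion (Set.mem_range_self ω) (Set.mem_range_self ω)
  · have hunion : (fun ω => g (f ω) ω) ⁻¹' {e} = ⋃ c ∈ Set.range f, f ⁻¹' {c} ∩ g c ⁻¹' {e} := by
      ext ω
      simp only [Set.mem_preimage, Set.mem_singleton_iff, Set.mem_iUnion, Set.mem_inter_iff]
      exact ⟨fun h => ⟨f ω, ⟨ω, rfl⟩, rfl, h⟩, fun ⟨_, _, hc, h⟩ => hc ▸ h⟩
    rw [hunion]
    exact .biUnion hf.1 fun c _ => (hf.2 c).inter ((hg c).2 e)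

theorem comp {f : Ω → γ} (hf : CountablyMeasurable f) (g : γ → δ) :
    CountablyMeasurable fun ω => g (f ω) :=
  hf.bind fun c => const (g c)

theorem prodMk {f : Ω → γ} {g : Ω → δ} (hf : CountablyMeasurable f)
    (hg : CountablyMeasurable g) : CountablyMeasurable fun ω => (f ω, g ω) :=
  hf.bind fun c => hg.comp (Prod.mk c)

end CountablyMeasurable

/-- Cutting along the values of `f` and transforming each piece with its own measure-preserving
map is allowed as soon as the pieces are not mixed, so that `f` is unchanged. -/
theorem measure_le_of_adaptive {Ω γ : Type*} [MeasurableSpace Ω] {μ : MeasureTheory.Measure Ω}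
    {f : Ω → γ} (hf : CountablyMeasurable f) {Φ : γ → Ω → Ω}
    (hΦ : ∀ c, MeasureTheory.MeasurePreserving (Φ c) μ μ) {E E' : Set Ω}
    (hE : ∀ ω ∈ E, f (Φ (f ω) ω) = f ω ∧ Φ (f ω) ω ∈ E') : μ E ≤ μ E' := by
  have hsum (s : Set Ω) : ∑' c : Set.range f, μ (f ⁻¹' {c.1} ∩ s) = μ s := by
    simpa [MeasureTheory.Measure.restrict_apply (hf.2 _)] using
      MeasureTheory.tsum_measure_preimage_singleton (μ := μ.restrict s) hf.1 fun c _ => hf.2 c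
  rw [← hsum E, ← hsum E']
  refine ENNReal.tsum_le_tsum fun c => ?_
  calc μ (f ⁻¹' {c.1} ∩ E) ≤ μ (Φ c ⁻¹' (f ⁻¹' {c.1} ∩ E')) := by
        refine MeasureTheory.measure_mono ?_
        rintro ω ⟨hc : f ω = c.1, hω⟩
        have h := hE ω hω
        rwa [hc] at h
    _ ≤ μ (f ⁻¹' {c.1} ∩ E') := (hΦ c).measure_preimage_le _

/-! ### Interactions -/

namespace Interaction

variable {Q : Type} {Ans : Q → Type} {α β : Type}

theorem run_congr {f g : ∀ q, Ans q} (s : Interaction Q Ans α)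
    (h : ∀ q ∈ s.asked f, f q = g q) : s.run f = s.run g := by
  induction s with
  | done a => rfl
  | ask q next ih =>
    simp only [asked, List.forall_mem_cons] at h
    rw [run, run, ← h.1, ih _ h.2]

theorem take_asked_congr {f g : ∀ q, Ans q} (s : Interaction Q Ans α) (j : ℕ)
    (h : ∀ q ∈ (s.asked f).take j, f q = g q) :
    (s.asked f).take (j + 1) = (s.asked g).take (j + 1) := by
  induction s generalizing j with
  | done a => rfl
  | ask q next ih =>
    cases j with
    | zero => simp [asked]
    | succ j =>
      simp only [asked, List.take_succ_cons, List.forall_mem_cons] at h ⊢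
      rw [← h.1, ih _ j h.2]

theorem exists_common_asked {f g : ∀ q, Ans q} {Bad : Q → Prop}
    (hfg : ∀ q, ¬ Bad q → f q = g q) (s : Interaction Q Ans α)
    (h : ∃ q ∈ s.asked f, Bad q) : ∃ q ∈ s.asked f, q ∈ s.asked g ∧ Bad q := by
  induction s with
  | done a => simp [asked] at h
  | ask q next ih =>
    by_cases hq : Bad q
    · exact ⟨q, by simp [asked], by simp [asked], hq⟩
    · simp only [asked, List.exists_mem_cons_iff, hq, false_or, ← hfg q hq] at h ⊢
      obtain ⟨y, hy, hy', hb⟩ := ih (f q) h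
      exact Or.inr ⟨y, hy, List.mem_cons_of_mem _ hy', hb⟩

/-- Run one interaction and continue with its output. -/
def bind : Interaction Q Ans α → (α → Interaction Q Ans β) → Interaction Q Ans β
  | done a, k => k a
  | ask q next, k => ask q fun x => (next x).bind k

theorem run_bind (f : ∀ q, Ans q) (s : Interaction Q Ans α) (k : α → Interaction Q Ans β) :
    (s.bind k).run f = (k (s.run f)).run f := by
  induction s with
  | done a => rfl
  | ask q _ ih => exact ih (f q)

theorem asked_bind (f : ∀ q, Ans q) (s : Interaction Q Ans α) (k : α → Interaction Q Ans β) :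
    (s.bind k).asked f = s.asked f ++ (k (s.run f)).asked f := by
  induction s with
  | done a => rfl
  | ask q next ih => simp only [bind, asked, run, List.cons_append, ih (f q)]

variable {Ω : Type*} [MeasurableSpace Ω] {answer : Ω → ∀ q, Ans q}

theorem countablyMeasurable_run (hanswer : ∀ q, CountablyMeasurable fun ω => answer ω q)
    (s : Interaction Q Ans α) : CountablyMeasurable fun ω => s.run (answer ω) := by
  induction s with
  | done a => exact .const a
  | ask q next ih => exact (hanswer q).bind ih

theorem countablyMeasurable_asked (hanswer : ∀ q, CountablyMeasurable fun ω => answer ω q)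
    (s : Interaction Q Ans α) : CountablyMeasurable fun ω => s.asked (answer ω) := by
  induction s with
  | done _ => exact .const []
  | ask q next ih => exact ((hanswer q).bind ih).comp (List.cons q)

end Interaction

/-! ### The law of the random oracle -/

section OracleLaw

open MeasureTheory Measure
open scoped symmDiff

theorem measurePreserving_update_infinitePi {ι : Type*} [DecidableEq ι] {X : ι → Type*}
    [∀ i, MeasurableSpace (X i)] (μ : ∀ i, Measure (X i)) [∀ i, IsProbabilityMeasure (μ i)]
    (i : ι) {g : X i → X i} (hg : MeasurePreserving g (μ i) (μ i)) :
    MeasurePreserving (fun x => Function.update x i (g (x i))) (infinitePi μ) (infinitePi μ) := by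
  let f : ∀ k, X k → X k := Function.update (fun _ => id) i g
  have hf (k : ι) : MeasurePreserving (f k) (μ k) (μ k) := by
    obtain rfl | hk := eq_or_ne k i
    · simpa [f] using hg
    · simpa [f, hk] using MeasurePreserving.id (μ k)
  have hfun : (fun (x : ∀ k, X k) => Function.update x i (g (x i))) = fun x k => f k (x k) := by
    ext x k
    obtain rfl | hk := eq_or_ne k i <;> simp [f, *]
  refine ⟨by have := hg.measurable; fun_prop, ?_⟩
  rw [hfun, infinitePi_map_pi μ fun k => (hf k).measurable]
  exact congrArg _ (funext fun k => (hf k).map_eq)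

theorem measurePreserving_comp_perm_infinitePi {ι X : Type*} [MeasurableSpace X]
    (μ : Measure X) [IsProbabilityMeasure μ] (e : Equiv.Perm ι) :
    MeasurePreserving (fun x : ι → X => x ∘ e)
      (infinitePi fun _ => μ) (infinitePi fun _ => μ) := by
  have hfun : (fun x : ι → X => x ∘ e) = MeasurableEquiv.piCongrLeft (fun _ => X) e.symm := by
    ext x i
    simp [MeasurableEquiv.coe_piCongrLeft, Equiv.piCongrLeft_apply]
  refine ⟨by fun_prop, ?_⟩
  rw [hfun]
  exact infinitePi_map_piCongrLeft (fun _ => μ) e.symm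

theorem measurePreserving_uniformOfFintype {α : Type*} [Fintype α] [Nonempty α]
    [MeasurableSpace α] [MeasurableSingletonClass α] (e : Equiv.Perm α) :
    MeasurePreserving e (PMF.uniformOfFintype α).toMeasure (PMF.uniformOfFintype α).toMeasure := by
  refine ⟨measurable_of_finite e, Measure.ext_of_singleton fun a => ?_⟩
  rw [map_apply (measurable_of_finite e) (measurableSet_singleton a),
    ← e.image_symm_eq_preimage, Set.image_singleton]
  simp only [PMF.toMeasure_apply_singleton _ _ (measurableSet_singleton _),
    PMF.uniformOfFintype_apply]

variable {κ : ℕ}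

instance : IsProbabilityMeasure (oracleLaw κ) :=
  inferInstanceAs (IsProbabilityMeasure (infinitePi _))

theorem measurePreserving_update_oracleLaw (x : List Bool) (e : Equiv.Perm (Hash κ)) :
    MeasurePreserving (fun H : Oracle κ => Function.update H x (e (H x)))
      (oracleLaw κ) (oracleLaw κ) :=
  measurePreserving_update_infinitePi _ x (measurePreserving_uniformOfFintype e)

theorem measurePreserving_comp_perm_oracleLaw (e : Equiv.Perm (List Bool)) :
    MeasurePreserving (fun H : Oracle κ => H ∘ e) (oracleLaw κ) (oracleLaw κ) :=
  measurePreserving_comp_perm_infinitePi _ e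

theorem countablyMeasurable_eval (x : List Bool) :
    CountablyMeasurable fun H : Oracle κ => H x :=
  .of_measurable (measurable_pi_apply x)

end OracleLaw

/-! ### Collisions -/

section Collision

open MeasureTheory
open scoped symmDiff

variable {κ : ℕ} {α : Type}

/-- The oracles for which the `j`-th question of `s` is new and its answer differs from the answer
to the `i`-th question by `h`. For `h = ⊥` it is a collision; all `h` are equally likely. -/
def differSet (s : OracleStrategy κ α) (i j : ℕ) (h : Hash κ) : Set (Oracle κ) :=
  {H | j < (s.asked H).length ∧ (s.asked H).getD j [] ∉ (s.asked H).take j ∧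
    H ((s.asked H).getD j []) = h ∆ H ((s.asked H).getD i [])}

theorem measurableSet_differSet (s : OracleStrategy κ α) (i j : ℕ) (h : Hash κ) :
    MeasurableSet (differSet s i j h) := by
  have htranscript : CountablyMeasurable fun H : Oracle κ =>
      (s.asked H, H ((s.asked H).getD i []), H ((s.asked H).getD j [])) :=
    (s.countablyMeasurable_asked countablyMeasurable_eval).bind
      (g := fun l H => (l, H (l.getD i []), H (l.getD j []))) fun l =>
      (CountablyMeasurable.const l).prodMk
        ((countablyMeasurable_eval _).prodMk (countablyMeasurable_eval _))
  exact htranscript.measurableSet_preimage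
    {t | j < t.1.length ∧ t.1.getD j [] ∉ t.1.take j ∧ t.2.2 = h ∆ t.2.1}

theorem disjoint_differSet (s : OracleStrategy κ α) (i j : ℕ) {h h' : Hash κ} (hne : h ≠ h') :
    Disjoint (differSet s i j h) (differSet s i j h') :=
  Set.disjoint_left.2 fun _ hH hH' =>
    hne (symmDiff_left_injective _ (hH.2.2.symm.trans hH'.2.2))

theorem oracleLaw_differSet_bot_le (s : OracleStrategy κ α) {i j : ℕ} (hij : i < j)
    (h : Hash κ) : oracleLaw κ (differSet s i j ⊥) ≤ oracleLaw κ (differSet s i j h) := by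
  let shift : Equiv.Perm (Hash κ) := (symmDiff_right_involutive h).toPerm
  refine measure_le_of_adaptive
    ((s.countablyMeasurable_asked countablyMeasurable_eval).comp (List.take (j + 1)))
    (fun l => measurePreserving_update_oracleLaw (l.getD j []) shift) ?_
  rintro H ⟨hj, hnew, hcoll⟩
  have hgetD {l : List (List Bool)} {k : ℕ} (hk : k ≤ j) :
      (l.take (j + 1)).getD k [] = l.getD k [] := by
    simp [List.getD_eq_getElem?_getD, List.getElem?_take_of_lt (Nat.lt_succ_of_le hk)]
  rw [hgetD le_rfl]
  set y := (s.asked H).getD j []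
  set x := (s.asked H).getD i [] with hx
  set H' := Function.update H y (shift (H y))
  have htake : (s.asked H').take (j + 1) = (s.asked H).take (j + 1) :=
    (s.take_asked_congr j fun q hq =>
      (Function.update_of_ne (ne_of_mem_of_not_mem hq hnew) _ _).symm).symm
  have hxy : x ≠ y := by
    refine ne_of_mem_of_not_mem (List.mem_iff_getElem?.2 ⟨i, ?_⟩) hnew
    rw [List.getElem?_take_of_lt hij, List.getElem?_eq_getElem (hij.trans hj), hx,
      List.getD_eq_getElem]
  have hgetD' {k : ℕ} (hk : k ≤ j) : (s.asked H').getD k [] = (s.asked H).getD k [] := by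
    rw [← hgetD hk, htake, hgetD hk]
  refine ⟨htake, ?_, ?_, ?_⟩
  · have := congrArg List.length htake
    simp only [List.length_take] at this
    omega
  · have := congrArg (List.take j) htake
    simp only [List.take_take, Nat.min_eq_left j.le_succ] at this
    rwa [hgetD' le_rfl, this]
  · rw [hgetD' le_rfl, hgetD' hij.le]
    change H' y = h ∆ H' x
    simp only [H', Function.update_self, Function.update_of_ne hxy, hcoll, bot_symmDiff]
    rfl

theorem oracleLaw_differSet_bot_le_inv (s : OracleStrategy κ α) {i j : ℕ} (hij : i < j) :
    oracleLaw κ (differSet s i j ⊥) ≤ (2 ^ κ)⁻¹ := by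
  rw [← one_div, ENNReal.le_div_iff_mul_le (by simp) (by simp)]
  calc oracleLaw κ (differSet s i j ⊥) * 2 ^ κ
      = ∑ _h : Hash κ, oracleLaw κ (differSet s i j ⊥) := by simp [mul_comm]
    _ ≤ ∑ h : Hash κ, oracleLaw κ (differSet s i j h) :=
        Finset.sum_le_sum fun h _ => oracleLaw_differSet_bot_le s hij h
    _ = oracleLaw κ (⋃ h ∈ Finset.univ, differSet s i j h) :=
        (measure_biUnion_finset (fun _ _ _ _ hne => disjoint_differSet s i j hne)
          fun h _ => measurableSet_differSet s i j h).symm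
    _ ≤ 1 := prob_le_one

theorem exists_differSet_bot_of_not_injOn {s : OracleStrategy κ α} {H : Oracle κ}
    (h : ¬ Set.InjOn H {x | x ∈ s.asked H}) :
    ∃ i j, i < j ∧ j < (s.asked H).length ∧ H ∈ differSet s i j ⊥ := by
  suffices hsuff : ∀ x ∈ s.asked H, ∀ y ∈ s.asked H,
      (s.asked H).idxOf x < (s.asked H).idxOf y → H x = H y →
      ∃ i j, i < j ∧ j < (s.asked H).length ∧ H ∈ differSet s i j ⊥ by
    simp only [Set.InjOn, not_forall, Set.mem_ofPred_eq] at h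
    obtain ⟨x, hx, y, hy, hxy, hne⟩ := h
    rcases lt_or_gt_of_ne fun h => hne ((List.idxOf_inj hx).1 h) with hlt | hlt
    · exact hsuff x hx y hy hlt hxy
    · exact hsuff y hy x hx hlt hxy.symm
  intro x hx y hy hlt hxy
  have hy' := List.idxOf_lt_length_of_mem hy
  refine ⟨_, _, hlt, hy', hy', ?_⟩
  simp [List.getD_eq_getElem?_getD, List.getElem?_idxOf hx, List.getElem?_idxOf hy,
    List.mem_take_iff_idxOf_lt hy, hxy]

theorem oracleLaw_not_injOn_asked_le (s : OracleStrategy κ α) {q : ℕ}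
    (hs : ∀ H, (s.asked H).length ≤ q) :
    oracleLaw κ {H | ¬ Set.InjOn H {x | x ∈ s.asked H}} ≤ q ^ 2 / 2 ^ κ := by
  let pairs := (Finset.range q ×ˢ Finset.range q).filter fun p => p.1 < p.2
  have hcard : pairs.card ≤ q ^ 2 :=
    (Finset.card_filter_le _ _).trans (by simp [sq])
  have hsub : {H | ¬ Set.InjOn H {x | x ∈ s.asked H}} ⊆
      ⋃ p ∈ pairs, differSet s p.1 p.2 ⊥ := by
    intro H hH
    obtain ⟨i, j, hij, hj, hmem⟩ := exists_differSet_bot_of_not_injOn hH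
    have hjq := hj.trans_le (hs H)
    exact Set.mem_biUnion (x := (i, j)) (by simp [pairs, hij, hjq, hij.trans hjq]) hmem
  calc oracleLaw κ {H | ¬ Set.InjOn H {x | x ∈ s.asked H}}
      ≤ ∑ p ∈ pairs, oracleLaw κ (differSet s p.1 p.2 ⊥) :=
        (measure_mono hsub).trans (measure_biUnion_finset_le _ _)
    _ ≤ ∑ _p ∈ pairs, (2 ^ κ)⁻¹ := Finset.sum_le_sum fun p hp =>
        oracleLaw_differSet_bot_le_inv s (Finset.mem_filter.1 hp).2
    _ ≤ q ^ 2 / 2 ^ κ := by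
        rw [Finset.sum_const, nsmul_eq_mul, ENNReal.div_eq_inv_mul, mul_comm]
        gcongr
        exact_mod_cast hcard

end Collision

/-! ### Probabilities in the random oracle model -/

theorem tsum_toReal_mul_mem_Icc {α : Type*} (D : PMF α) {f : α → ℝ} {l u : ℝ}
    (hf : ∀ x ∈ D.support, f x ∈ Set.Icc l u) :
    ∑' x, (D x).toReal * f x ∈ Set.Icc l u := by
  have hD : HasSum (fun x => (D x).toReal) 1 := by
    have h := (ENNReal.summable_toReal D.tsum_coe_ne_top).hasSum
    rwa [← ENNReal.tsum_toReal_eq D.apply_ne_top, D.tsum_coe, ENNReal.toReal_one] at h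
  have hmem (x : α) : (D x).toReal * f x ∈ Set.Icc ((D x).toReal * l) ((D x).toReal * u) := by
    by_cases hx : x ∈ D.support
    · exact ⟨mul_le_mul_of_nonneg_left (hf x hx).1 ENNReal.toReal_nonneg,
        mul_le_mul_of_nonneg_left (hf x hx).2 ENNReal.toReal_nonneg⟩
    · simp [(D.apply_eq_zero_iff x).2 hx]
  have hl : HasSum (fun x => (D x).toReal * l) l := by simpa using hD.mul_right l
  have hu : HasSum (fun x => (D x).toReal * u) u := by simpa using hD.mul_right u
  have hsummable : Summable fun x => (D x).toReal * f x := by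
    simpa using (Summable.of_nonneg_of_le (fun x => sub_nonneg.2 (hmem x).1)
      (fun x => sub_le_sub_right (hmem x).2 _) (hu.sub hl).summable).add hl.summable
  exact ⟨hasSum_le (fun x => (hmem x).1) hl hsummable.hasSum,
    hasSum_le (fun x => (hmem x).2) hsummable.hasSum hu⟩

section RomProb

variable {κ : ℕ} {α β : Type}

theorem romProb_eq_tsum (D : PMF α) (E : Oracle κ → α → Prop) :
    romProb D E = ∑' x, (D x).toReal * (oracleLaw κ).real {H | E H x} := by
  rw [romProb, ENNReal.tsum_toReal_eq fun x =>
    ENNReal.mul_ne_top (D.apply_ne_top x) (MeasureTheory.measure_ne_top _ _)]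
  simp only [ENNReal.toReal_mul, MeasureTheory.measureReal_def]

theorem romProb_pure (x : α) (E : Oracle κ → α → Prop) :
    romProb (PMF.pure x) E = (oracleLaw κ).real {H | E H x} := by
  classical
  rw [romProb_eq_tsum, tsum_eq_single x fun y hy => by simp [hy]]
  simp

theorem romProb_bind (D : PMF β) (f : β → PMF α) (E : Oracle κ → α → Prop) :
    romProb (D.bind f) E = ∑' b, (D b).toReal * romProb (f b) E := by
  have hle (b : β) : ∑' x, f b x * oracleLaw κ {H | E H x} ≤ 1 := by
    calc ∑' x, f b x * oracleLaw κ {H | E H x} ≤ ∑' x, f b x :=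
          ENNReal.tsum_le_tsum fun x => mul_le_of_le_one_right' MeasureTheory.prob_le_one
      _ = 1 := (f b).tsum_coe
  have hswap : ∑' x, (D.bind f) x * oracleLaw κ {H | E H x} =
      ∑' b, D b * ∑' x, f b x * oracleLaw κ {H | E H x} := by
    simp only [PMF.bind_apply, ← ENNReal.tsum_mul_right, ← ENNReal.tsum_mul_left, mul_assoc]
    exact ENNReal.tsum_comm
  rw [romProb, hswap, ENNReal.tsum_toReal_eq fun b =>
    ENNReal.mul_ne_top (D.apply_ne_top b) ((hle b).trans_lt ENNReal.one_lt_top).ne]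
  simp only [ENNReal.toReal_mul, romProb]

theorem romProb_uniformOfFintype_bind [Fintype β] [Nonempty β] (f : β → PMF α)
    (E : Oracle κ → α → Prop) :
    romProb ((PMF.uniformOfFintype β).bind f) E = (∑ b, romProb (f b) E) / Fintype.card β := by
  rw [romProb_bind, tsum_fintype, Finset.sum_div]
  simp [PMF.uniformOfFintype_apply, div_eq_inv_mul]

/-- Finding a collision among at most `q` values of the oracle is a birthday problem; `s x`
replays the adversary `x` together with the verification of its output. -/
theorem romProb_le_of_collision {D : PMF α} {E : Oracle κ → α → Prop} {q : ℕ}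
    (s : α → OracleStrategy κ β) (hlength : ∀ x ∈ D.support, ∀ H, ((s x).asked H).length ≤ q)
    (hE : ∀ x H, E H x → ¬ Set.InjOn H {y | y ∈ (s x).asked H}) :
    romProb D E ≤ (q : ℝ) ^ 2 / 2 ^ κ := by
  rw [romProb_eq_tsum]
  refine (tsum_toReal_mul_mem_Icc D fun x hx => ⟨MeasureTheory.measureReal_nonneg, ?_⟩).2
  calc (oracleLaw κ).real {H | E H x}
      ≤ (oracleLaw κ).real {H | ¬ Set.InjOn H {y | y ∈ (s x).asked H}} :=
        MeasureTheory.measureReal_mono fun H => hE x H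
    _ ≤ (q : ℝ) ^ 2 / 2 ^ κ := by
        simpa [MeasureTheory.measureReal_def] using ENNReal.toReal_mono
          (ENNReal.div_ne_top (by simp) (by simp))
          (oracleLaw_not_injOn_asked_le (s x) (hlength x hx))

end RomProb

section Merkle

variable {κ d : ℕ} {V R : Type} {encV : V → List Bool} {encR : R → List Bool}

/-! ### Correctness -/

theorem pathHash_sibling (H : Oracle κ) (leaf : ℕ → Hash κ) (i n : ℕ) (hn : n ≤ d) :
    pathHash H i (leaf i)
      (fun m : Fin d => nodeHash H d leaf m (sibling (i / 2 ^ (m : ℕ)))) n hn =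
      nodeHash H d leaf n (i / 2 ^ n) := by
  induction n with
  | zero => simp [pathHash, nodeHash]
  | succ n ih =>
    have hdiv : i / 2 ^ (n + 1) = i / 2 ^ n / 2 := by rw [pow_succ, Nat.div_div_eq_div_mul]
    rw [pathHash, nodeHash, ih]
    simp only [hdiv, sibling]
    generalize i / 2 ^ n = m
    split_ifs with h
    · rw [show 2 * (m / 2) = m by omega]
    · rw [show 2 * (m / 2) = m - 1 by omega, show m - 1 + 1 = m by omega]

theorem leafHashes_of_fin (H : Oracle κ) (v : Fin (2 ^ d) → V) (r : Fin (2 ^ d) → R)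
    (i : Fin (2 ^ d)) :
    leafHashes encV encR H v r i = leafHash encV encR H d i (v i) (r i) := by
  simp [leafHashes]

theorem merkleVC_correct : (merkleVC κ d encV encR).Correct := by
  intro H v r i
  have h := pathHash_sibling (d := d) H (leafHashes encV encR H v r) i d le_rfl
  rw [leafHashes_of_fin, Nat.div_eq_of_lt i.2] at h
  simpa [merkleVC] using h

/-! ### The algorithms as strategies -/

/-- Ask for the hash of an interior node. -/
def interiorStrategy (d n j : ℕ) (h₀ h₁ : Hash κ) : OracleStrategy κ (Hash κ) :=
  .ask (nodeBits d n j ++ List.ofFn h₀ ++ List.ofFn h₁) .done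

/-- Ask for the hash of a leaf. -/
def leafStrategy (κ : ℕ) (encV : V → List Bool) (encR : R → List Bool) (d j : ℕ) (v : V) (r : R) :
    OracleStrategy κ (Hash κ) :=
  .ask (nodeBits d 0 j ++ encV v ++ encR r) .done

/-- Compute the hash of a node of the tree. -/
def nodeStrategy (κ : ℕ) (encV : V → List Bool) (encR : R → List Bool) (v : Fin (2 ^ d) → V)
    (r : Fin (2 ^ d) → R) : ℕ → ℕ → OracleStrategy κ (Hash κ)
  | 0, j => if h : j < 2 ^ d then leafStrategy κ encV encR d j (v ⟨j, h⟩) (r ⟨j, h⟩)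
      else .done fun _ => false
  | n + 1, j =>
    (nodeStrategy κ encV encR v r n (2 * j)).bind fun h₀ =>
      (nodeStrategy κ encV encR v r n (2 * j + 1)).bind fun h₁ =>
        interiorStrategy d (n + 1) j h₀ h₁

theorem run_nodeStrategy (H : Oracle κ) (v : Fin (2 ^ d) → V) (r : Fin (2 ^ d) → R) (n j : ℕ) :
    (nodeStrategy κ encV encR v r n j).run H =
      nodeHash H d (leafHashes encV encR H v r) n j := by
  induction n generalizing j with
  | zero =>
    simp only [nodeStrategy, nodeHash, leafHashes]
    split_ifs <;> rfl
  | succ n ih =>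
    simp only [nodeStrategy, Interaction.run_bind, ih]
    rfl

theorem length_asked_nodeStrategy (H : Oracle κ) (v : Fin (2 ^ d) → V) (r : Fin (2 ^ d) → R)
    (n j : ℕ) : ((nodeStrategy κ encV encR v r n j).asked H).length ≤ 2 ^ (n + 1) - 1 := by
  induction n generalizing j with
  | zero =>
    simp only [nodeStrategy]
    split_ifs <;> simp [leafStrategy, Interaction.asked]
  | succ n ih =>
    have h0 := ih (2 * j)
    have h1 := ih (2 * j + 1)
    have : 0 < 2 ^ n := by positivity
    simp only [nodeStrategy, Interaction.asked_bind, List.length_append, interiorStrategy,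
      Interaction.asked, List.length_cons, List.length_nil]
    rw [pow_succ] at h0 h1 ⊢
    rw [pow_succ]
    omega

/-- Recompute the hashes along a path. -/
def pathStrategy (i : ℕ) (leaf : OracleStrategy κ (Hash κ)) (w : Fin d → Hash κ) :
    ∀ n : ℕ, n ≤ d → OracleStrategy κ (Hash κ)
  | 0, _ => leaf
  | n + 1, hn =>
    (pathStrategy i leaf w n (Nat.le_of_succ_le hn)).bind fun h =>
      if i / 2 ^ n % 2 = 0 then interiorStrategy d (n + 1) (i / 2 ^ (n + 1)) h (w ⟨n, hn⟩)
      else interiorStrategy d (n + 1) (i / 2 ^ (n + 1)) (w ⟨n, hn⟩) h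

theorem run_pathStrategy (H : Oracle κ) (i : ℕ) (leaf : OracleStrategy κ (Hash κ))
    (w : Fin d → Hash κ) (n : ℕ) (hn : n ≤ d) :
    (pathStrategy i leaf w n hn).run H = pathHash H i (leaf.run H) w n hn := by
  induction n with
  | zero => rfl
  | succ n ih =>
    simp only [pathStrategy, Interaction.run_bind, ih, pathHash]
    split_ifs <;> rfl

theorem length_asked_pathStrategy (H : Oracle κ) (i : ℕ) (leaf : OracleStrategy κ (Hash κ))
    (w : Fin d → Hash κ) (n : ℕ) (hn : n ≤ d) :
    ((pathStrategy i leaf w n hn).asked H).length = (leaf.asked H).length + n := by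
  induction n with
  | zero => rfl
  | succ n ih =>
    simp only [pathStrategy, Interaction.asked_bind, List.length_append, ih]
    split_ifs <;> simp [interiorStrategy, Interaction.asked] <;> omega

/-! ### Binding -/

theorem append_ofFn_inj {l : List Bool} {a b a' b' : Hash κ}
    (h : l ++ List.ofFn a ++ List.ofFn b = l ++ List.ofFn a' ++ List.ofFn b') :
    a = a' ∧ b = b' := by
  rw [List.append_assoc, List.append_assoc] at h
  obtain ⟨h1, h2⟩ := List.append_inj (List.append_cancel_left h) (by simp)
  exact ⟨List.ofFn_injective h1, List.ofFn_injective h2⟩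

theorem leaf_inj (henc : Function.Injective fun x : V × R => encV x.1 ++ encR x.2)
    {l : List Bool} {v v' : V} {r r' : R}
    (h : l ++ encV v ++ encR r = l ++ encV v' ++ encR r') : v = v' ∧ r = r' := by
  rw [List.append_assoc, List.append_assoc] at h
  exact Prod.mk.inj (henc (a₁ := (v, r)) (a₂ := (v', r')) (List.append_cancel_left h))

theorem leaves_eq_of_nodeHash_eq
    (henc : Function.Injective fun x : V × R => encV x.1 ++ encR x.2) {H : Oracle κ}
    {S : Set (List Bool)} (hS : Set.InjOn H S) {v v' : Fin (2 ^ d) → V} {r r' : Fin (2 ^ d) → R}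
    {n j : ℕ} (h1 : ∀ x ∈ (nodeStrategy κ encV encR v r n j).asked H, x ∈ S)
    (h2 : ∀ x ∈ (nodeStrategy κ encV encR v' r' n j).asked H, x ∈ S)
    (heq : nodeHash H d (leafHashes encV encR H v r) n j =
      nodeHash H d (leafHashes encV encR H v' r') n j)
    (m : Fin (2 ^ d)) (hm : (m : ℕ) / 2 ^ n = j) : v m = v' m ∧ r m = r' m := by
  induction n generalizing j with
  | zero =>
    obtain rfl : (m : ℕ) = j := by simpa using hm
    simp only [nodeStrategy, m.2, dif_pos, leafStrategy, Interaction.asked, List.mem_singleton,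
      forall_eq, Fin.eta] at h1 h2
    simp only [nodeHash, leafHashes_of_fin] at heq
    exact leaf_inj henc (hS h1 h2 heq)
  | succ n ih =>
    simp only [nodeStrategy, Interaction.asked_bind, List.mem_append, interiorStrategy,
      Interaction.asked, List.mem_singleton, run_nodeStrategy] at h1 h2
    have h3 := append_ofFn_inj (hS (h1 _ (Or.inr (Or.inr rfl))) (h2 _ (Or.inr (Or.inr rfl))) heq)
    rw [pow_succ, ← Nat.div_div_eq_div_mul] at hm
    rcases Nat.even_or_odd' ((m : ℕ) / 2 ^ n) with ⟨t, ht | ht⟩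
    · obtain rfl : t = j := by omega
      exact ih (fun x hx => h1 x (Or.inl hx)) (fun x hx => h2 x (Or.inl hx)) h3.1 ht
    · obtain rfl : t = j := by omega
      exact ih (fun x hx => h1 x (Or.inr (Or.inl hx))) (fun x hx => h2 x (Or.inr (Or.inl hx)))
        h3.2 ht

theorem leaf_eq_of_pathHash_eq
    (henc : Function.Injective fun x : V × R => encV x.1 ++ encR x.2) {H : Oracle κ}
    {S : Set (List Bool)} (hS : Set.InjOn H S) {i j : ℕ} {v v' : V} {r r' : R}
    {w w' : Fin d → Hash κ} {n : ℕ} (hn : n ≤ d)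
    (h1 : ∀ x ∈ (pathStrategy i (leafStrategy κ encV encR d j v r) w n hn).asked H, x ∈ S)
    (h2 : ∀ x ∈ (pathStrategy i (leafStrategy κ encV encR d j v' r') w' n hn).asked H, x ∈ S)
    (heq : pathHash H i (leafHash encV encR H d j v r) w n hn =
      pathHash H i (leafHash encV encR H d j v' r') w' n hn) : v = v' ∧ r = r' := by
  induction n with
  | zero =>
    simp only [pathStrategy, leafStrategy, Interaction.asked, List.mem_singleton,
      forall_eq] at h1 h2
    exact leaf_inj henc (hS h1 h2 heq)
  | succ n ih =>
    simp only [pathStrategy, Interaction.asked_bind, List.mem_append, run_pathStrategy] at h1 h2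
    refine ih _ (fun x hx => h1 x (Or.inl hx)) (fun x hx => h2 x (Or.inl hx)) ?_
    simp only [pathHash] at heq
    split_ifs at heq h1 h2
    · simp only [interiorStrategy, Interaction.asked, List.mem_singleton] at h1 h2
      exact (append_ofFn_inj (hS (h1 _ (Or.inr rfl)) (h2 _ (Or.inr rfl)) heq)).1
    · simp only [interiorStrategy, Interaction.asked, List.mem_singleton] at h1 h2
      exact (append_ofFn_inj (hS (h1 _ (Or.inr rfl)) (h2 _ (Or.inr rfl)) heq)).2

theorem merkleVC_bindingProb_le
    (henc : Function.Injective fun x : V × R => encV x.1 ++ encR x.2) (q : ℕ)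
    (A : PMF (merkleVC κ d encV encR).BindingStrategy)
    (hA : ∀ a ∈ A.support, ∀ H : Oracle κ, (a.asked H).length ≤ q) :
    (merkleVC κ d encV encR).bindingProb A
      ≤ ((q : ℝ) + 2 * (2 ^ (d + 1) - 1)) ^ 2 / 2 ^ κ := by
  let replay (a : (merkleVC κ d encV encR).BindingStrategy) : OracleStrategy κ (Hash κ) :=
    a.bind fun (v, v', r, r') =>
      (nodeStrategy κ encV encR v r d 0).bind fun _ => nodeStrategy κ encV encR v' r' d 0
  have hlength (a) (ha : a ∈ A.support) (H : Oracle κ) :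
      ((replay a).asked H).length ≤ q + 2 * (2 ^ (d + 1) - 1) := by
    simp only [replay, Interaction.asked_bind, List.length_append, two_mul]
    exact add_le_add (hA a ha H)
      (add_le_add (length_asked_nodeStrategy ..) (length_asked_nodeStrategy ..))
  have hcast : ((q + 2 * (2 ^ (d + 1) - 1) : ℕ) : ℝ) = (q : ℝ) + 2 * (2 ^ (d + 1) - 1) := by
    push_cast [Nat.one_le_two_pow]
    rfl
  rw [← hcast]
  refine romProb_le_of_collision replay hlength fun a H hwin hinj => ?_
  simp only [replay, Interaction.asked_bind, List.mem_append] at hinj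
  simp only [VCScheme.BindingWin] at hwin
  obtain ⟨v, v', r, r'⟩ := a.run H
  have heq := leaves_eq_of_nodeHash_eq henc hinj (fun x hx => Or.inr (Or.inl hx))
    (fun x hx => Or.inr (Or.inr hx)) hwin.2
  have hroot (m : Fin (2 ^ d)) : (m : ℕ) / 2 ^ d = 0 := Nat.div_eq_of_lt m.2
  exact hwin.1.elim (fun hv => hv (funext fun m => (heq m (hroot m)).1))
    fun hr => hr (funext fun m => (heq m (hroot m)).2)

theorem merkleVC_positionProb_le
    (henc : Function.Injective fun x : V × R => encV x.1 ++ encR x.2) (q : ℕ)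
    (A : PMF (merkleVC κ d encV encR).PositionStrategy)
    (hA : ∀ a ∈ A.support, ∀ H : Oracle κ, (a.asked H).length ≤ q) :
    (merkleVC κ d encV encR).positionProb A ≤ ((q : ℝ) + 2 * (d + 1)) ^ 2 / 2 ^ κ := by
  let replay (a : (merkleVC κ d encV encR).PositionStrategy) : OracleStrategy κ (Hash κ) :=
    a.bind fun (_, i, v, v', r, r', w, w') =>
      (pathStrategy i (leafStrategy κ encV encR d i v r) w d le_rfl).bind fun _ =>
        pathStrategy i (leafStrategy κ encV encR d i v' r') w' d le_rfl
  have hlength (a) (ha : a ∈ A.support) (H : Oracle κ) :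
      ((replay a).asked H).length ≤ q + 2 * (d + 1) := by
    have hpath (i : ℕ) (v : V) (r : R) (w : Fin d → Hash κ) : ((pathStrategy i
        (leafStrategy κ encV encR d i v r) w d le_rfl).asked H).length ≤ d + 1 := by
      rw [length_asked_pathStrategy, add_comm]
      rfl
    simp only [replay, Interaction.asked_bind, List.length_append, two_mul]
    exact add_le_add (hA a ha H) (add_le_add (hpath ..) (hpath ..))
  have hcast : ((q + 2 * (d + 1) : ℕ) : ℝ) = (q : ℝ) + 2 * (d + 1) := by push_cast; rfl
  rw [← hcast]
  refine romProb_le_of_collision replay hlength fun a H hwin hinj => ?_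
  simp only [replay, Interaction.asked_bind, List.mem_append] at hinj
  simp only [VCScheme.PositionWin] at hwin
  obtain ⟨C, i, v, v', r, r', w, w'⟩ := a.run H
  simp only [merkleVC, decide_eq_true_eq] at hwin
  obtain ⟨hne, hpath, hpath'⟩ := hwin
  have heq := leaf_eq_of_pathHash_eq henc hinj le_rfl (fun x hx => Or.inr (Or.inl hx))
    (fun x hx => Or.inr (Or.inr hx)) (hpath.trans hpath'.symm)
  exact hne.elim (fun hv => hv heq.1) fun hr => hr heq.2

end Merkle

/-! ### Negligible functions -/

theorem tendsto_polynomial_eval_div_two_pow (P : Polynomial ℝ) :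
    Filter.Tendsto (fun n : ℕ => P.eval (n : ℝ) / 2 ^ n) Filter.atTop (nhds 0) := by
  induction P using Polynomial.induction_on' with
  | add P P' hP hP' => simpa [add_div] using hP.add hP'
  | monomial k a =>
    simpa [mul_div_assoc] using
      (tendsto_pow_const_div_const_pow_of_one_lt k (one_lt_two (α := ℝ))).const_mul a

theorem negligible_of_le_polynomial_div_two_pow {f : ℕ → ℝ} (P : Polynomial ℝ)
    (h : ∀ n, f n ≤ P.eval (n : ℝ) / 2 ^ n) : Negligible f := by
  intro c _
  obtain ⟨m, hm⟩ := exists_nat_ge c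
  obtain ⟨n₀, hn₀⟩ := Filter.eventually_atTop.1
    ((tendsto_polynomial_eval_div_two_pow (P * Polynomial.X ^ m)).eventually_lt_const zero_lt_one)
  refine ⟨max n₀ 1, fun n hn => ?_⟩
  have hn1 : (1 : ℝ) ≤ n := by exact_mod_cast (le_max_right _ _).trans hn
  have hlt : P.eval (n : ℝ) / 2 ^ n * (n : ℝ) ^ m < 1 := by
    simpa [div_mul_eq_mul_div] using hn₀ n ((le_max_left _ _).trans hn)
  calc f n ≤ P.eval (n : ℝ) / 2 ^ n := h n
    _ < 1 / (n : ℝ) ^ m := (lt_div_iff₀ (by positivity)).2 hlt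
    _ ≤ 1 / (n : ℝ) ^ c := by
      rw [← Real.rpow_natCast]
      exact one_div_le_one_div_of_le (by positivity) (Real.rpow_le_rpow_of_exponent_le hn1 hm)

theorem negligible_of_le_polynomial_eval_div_two_pow {f : ℕ → ℝ} (P : Polynomial ℝ)
    (p : Polynomial ℕ) (h : ∀ n, f n ≤ P.eval ((p.eval n : ℕ) : ℝ) / 2 ^ n) : Negligible f := by
  refine negligible_of_le_polynomial_div_two_pow (P.comp (p.map (Nat.castRingHom ℝ))) fun n => ?_
  rw [Polynomial.eval_comp, Polynomial.eval_natCast_map]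
  exact h n

/-! ### Identifiers of nodes -/

theorem flatMap_symbolBits_injective :
    Function.Injective fun l : List (Option Bool) => l.flatMap symbolBits := by
  intro l l' h
  induction l generalizing l' with
  | nil => rcases l' with _ | ⟨_ | _, _⟩ <;> simp_all [symbolBits]
  | cons a l ih =>
    rcases a with _ | a <;> rcases l' with _ | ⟨_ | a', l'⟩ <;>
      simp only [List.flatMap_cons, List.flatMap_nil, symbolBits, List.cons_append,
        List.nil_append, List.cons.injEq, reduceCtorEq, true_and, false_and, Bool.true_eq_false,
        Bool.false_eq_true] at h
    · rw [ih h]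
    · rw [h.1, ih h.2]

theorem length_nodeBits (d n j : ℕ) : (nodeBits d n j).length = 2 * d := by
  have hsymbol (a : Option Bool) : (symbolBits a).length = 2 := by cases a <;> rfl
  simp [nodeBits, nodeId, List.length_flatMap, hsymbol, Function.comp_def,
    List.ofFn_const, mul_comm]

theorem nodeId_eq_of_nodeBits_eq {d n j n' j' : ℕ} (h : nodeBits d n j = nodeBits d n' j') :
    nodeId d n j = nodeId d n' j' :=
  flatMap_symbolBits_injective h

theorem nodeBits_zero_injOn (d : ℕ) : Set.InjOn (nodeBits d 0) {j | j < 2 ^ d} := by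
  intro i hi j hj h
  have hbits := List.ofFn_injective (nodeId_eq_of_nodeBits_eq h)
  refine Nat.eq_of_testBit_eq fun t => ?_
  by_cases ht : t < d
  · have hrev : d - 1 - (d - 1 - t) = t := by omega
    simpa [hrev] using congrFun hbits ⟨d - 1 - t, by omega⟩
  · have hpow : 2 ^ d ≤ 2 ^ t := Nat.pow_le_pow_right two_pos (not_lt.1 ht)
    rw [Nat.testBit_lt_two_pow (lt_of_lt_of_le hi hpow),
      Nat.testBit_lt_two_pow (lt_of_lt_of_le hj hpow)]

/-- The last symbol is a star for the interior nodes only. -/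
theorem nodeBits_zero_ne_nodeBits_succ {d n : ℕ} (hn : n < d) (i j : ℕ) :
    nodeBits d 0 i ≠ nodeBits d (n + 1) j := by
  intro h
  have hlast := congrFun (List.ofFn_injective (nodeId_eq_of_nodeBits_eq h)) ⟨d - 1, by omega⟩
  simp at hlast

/-! ### Relabelling the leaves -/

section Relabel

variable {κ d : ℕ} {V R : Type} {encV : V → List Bool} {encR : R → List Bool}

/-- The point at which the oracle is evaluated to compute the hash of leaf `i` with value `v` and
salt `s`, for `t = (i, v, s)`. -/
def leafPoint (d : ℕ) (encV : V → List Bool) (encR : R → List Bool)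
    (t : Fin (2 ^ d) × V × R) : List Bool :=
  nodeBits d 0 t.1 ++ encV t.2.1 ++ encR t.2.2

theorem leafPoint_injective (henc : Function.Injective fun x : V × R => encV x.1 ++ encR x.2) :
    Function.Injective (leafPoint d encV encR) := by
  rintro ⟨i, v, r⟩ ⟨i', v', r'⟩ h
  simp only [leafPoint, List.append_assoc] at h
  obtain ⟨hnode, hleaf⟩ := List.append_inj h (by rw [length_nodeBits, length_nodeBits])
  obtain rfl := Fin.ext (nodeBits_zero_injOn d i.2 i'.2 hnode)
  rw [henc (a₁ := (v, r)) (a₂ := (v', r')) hleaf]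

theorem nodeBits_succ_append_ne_leafPoint {n : ℕ} (hn : n < d) (j : ℕ) (l l' : List Bool)
    (t : Fin (2 ^ d) × V × R) :
    nodeBits d (n + 1) j ++ l ++ l' ≠ leafPoint d encV encR t := by
  intro h
  simp only [leafPoint, List.append_assoc] at h
  exact nodeBits_zero_ne_nodeBits_succ hn t.1 j
    (List.append_inj h (by rw [length_nodeBits, length_nodeBits])).1.symm

/-- The permutation of the points of the oracle that relabels the value and the salt of leaf `i`
by `π i` and fixes all points that do not belong to a leaf. -/
noncomputable def leafPerm (henc : Function.Injective fun x : V × R => encV x.1 ++ encR x.2)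
    (π : Fin (2 ^ d) → Equiv.Perm (V × R)) : Equiv.Perm (List Bool) :=
  Equiv.Perm.viaEmbedding (Equiv.prodShear (Equiv.refl _) π)
    ⟨leafPoint d encV encR, leafPoint_injective henc⟩

variable (henc : Function.Injective fun x : V × R => encV x.1 ++ encR x.2)
  (π : Fin (2 ^ d) → Equiv.Perm (V × R))

theorem leafPerm_leafPoint (i : Fin (2 ^ d)) (z : V × R) :
    leafPerm henc π (leafPoint d encV encR (i, z)) = leafPoint d encV encR (i, π i z) :=
  Equiv.Perm.viaEmbedding_apply _ ⟨leafPoint d encV encR, leafPoint_injective henc⟩ (i, z)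

theorem leafPerm_of_notMem_range {x : List Bool} (hx : x ∉ Set.range (leafPoint d encV encR)) :
    leafPerm henc π x = x :=
  Equiv.Perm.viaEmbedding_apply_of_notMem _ _ x hx

variable {henc π}

theorem exists_leafPoint_of_leafPerm_ne {x : List Bool} (hx : leafPerm henc π x ≠ x) :
    ∃ i z, π i z ≠ z ∧ leafPoint d encV encR (i, z) = x := by
  by_contra! h
  by_cases hrange : x ∈ Set.range (leafPoint d encV encR)
  · obtain ⟨⟨i, z⟩, rfl⟩ := hrange
    refine h i z (fun hz => hx ?_) rfl
    rw [leafPerm_leafPoint, hz]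
  · exact hx (leafPerm_of_notMem_range henc π hrange)

theorem leafHashes_comp_leafPerm (H : Oracle κ) {v v' : Fin (2 ^ d) → V}
    {r r' : Fin (2 ^ d) → R} (hπ : ∀ i, π i (v' i, r' i) = (v i, r i)) :
    leafHashes encV encR (H ∘ leafPerm henc π) v' r' = leafHashes encV encR H v r := by
  ext1 j
  unfold leafHashes
  split_ifs with hj
  · have hpoint := leafPerm_leafPoint henc π ⟨j, hj⟩ (v' ⟨j, hj⟩, r' ⟨j, hj⟩)
    rw [hπ] at hpoint
    exact congrArg H hpoint
  · rfl

theorem nodeHash_comp_leafPerm (H : Oracle κ) (leaf : ℕ → Hash κ) {n : ℕ} (hn : n ≤ d) (j : ℕ) :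
    nodeHash (H ∘ leafPerm henc π) d leaf n j = nodeHash H d leaf n j := by
  induction n generalizing j with
  | zero => rfl
  | succ n ih =>
    simp only [nodeHash, ih (Nat.le_of_succ_le hn)]
    refine congrArg H (leafPerm_of_notMem_range henc π ?_)
    rintro ⟨t, ht⟩
    exact nodeBits_succ_append_ne_leafPoint hn j _ _ t ht.symm

variable {H : Oracle κ} {v v' : Fin (2 ^ d) → V} {r r' : Fin (2 ^ d) → R}

theorem commit_comp_leafPerm (hπ : ∀ i, π i (v' i, r' i) = (v i, r i)) :
    (merkleVC κ d encV encR).commit (H ∘ leafPerm henc π) v' r' =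
      (merkleVC κ d encV encR).commit H v r := by
  simp only [merkleVC, leafHashes_comp_leafPerm H hπ, nodeHash_comp_leafPerm H _ le_rfl]

theorem openAt_comp_leafPerm (hπ : ∀ i, π i (v' i, r' i) = (v i, r i)) :
    (merkleVC κ d encV encR).openAt (H ∘ leafPerm henc π) v' r' =
      (merkleVC κ d encV encR).openAt H v r := by
  refine funext fun i => funext fun n => ?_
  simp only [merkleVC, leafHashes_comp_leafPerm H hπ, nodeHash_comp_leafPerm H _ n.2.le]

end Relabel

/-! ### The view of the adversary in the hiding game -/

namespace VCScheme

variable {κ L : ℕ} {V R : Type} {S : VCScheme κ L V R}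

/-- Two runs of the challenger, with `H`, `b`, `r` and with `H'`, `b'`, `r'`, that a second phase
of the hiding game for the vectors `vs` can distinguish only by an oracle query in `P`. -/
structure SameView (S : VCScheme κ L V R) (vs : Bool → Fin L → V) (P : Set (List Bool))
    (H H' : Oracle κ) (b b' : Bool) (r r' : Fin L → R) : Prop where
  oracle : ∀ x ∉ P, H x = H' x
  commit : S.commit H (vs b) r = S.commit H' (vs b') r'
  salt : ∀ i, vs false i = vs true i → r i = r' i
  openAt : S.openAt H (vs b) r = S.openAt H' (vs b') r'

variable {P : Set (List Bool)} {H H' : Oracle κ} {a : S.HidingStrategy} {b b' : Bool}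
  {r r' : Fin L → R}

theorem SameView.guessAnswer_eq {vs : Bool → Fin L → V} (h : S.SameView vs P H H' b b' r r')
    (x : List Bool ⊕ Fin L) (hx : ¬ ∃ y ∈ P, .inl y = x) :
    S.guessAnswer H vs b r x = S.guessAnswer H' vs b' r' x := by
  cases x with
  | inl x => exact h.oracle x fun hxP => hx ⟨x, hxP, rfl⟩
  | inr i =>
    simp only [guessAnswer, h.openAt]
    split_ifs with hi
    · rw [h.salt i hi]
    · rfl

theorem run_eq_of_forall_asked {α : Type} {s : OracleStrategy κ α} (horacle : ∀ x ∉ P, H x = H' x)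
    (hasked : ∀ x ∈ P, x ∉ s.asked H) : s.run H = s.run H' :=
  s.run_congr fun x hx => horacle x fun hxP => hasked x hxP hx

theorem SameView.hidingGuess_eq (h : S.SameView (a.run H).1 P H H' b b' r r')
    (hfirst : ∀ x ∈ P, x ∉ a.asked H) (hsecond : ∀ x ∈ P, .inl x ∉ S.guessAsked H a b r) :
    S.hidingGuess H a b r = S.hidingGuess H' a b' r' := by
  simp only [hidingGuess, guessAsked, ← run_eq_of_forall_asked h.oracle hfirst, ← h.commit]
    at hsecond ⊢
  refine Interaction.run_congr _ fun x hx => h.guessAnswer_eq x ?_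
  rintro ⟨y, hy, rfl⟩
  exact hsecond y hy hx

theorem SameView.exists_common_guessAsked (h : S.SameView (a.run H).1 P H H' b b' r r')
    (hfirst : ∀ x ∈ P, x ∉ a.asked H) (hsecond : ∃ x ∈ P, .inl x ∈ S.guessAsked H a b r) :
    ∃ x ∈ P, .inl x ∈ S.guessAsked H a b r ∧ .inl x ∈ S.guessAsked H' a b' r' := by
  obtain ⟨x, hxP, hx⟩ := hsecond
  simp only [guessAsked, ← run_eq_of_forall_asked h.oracle hfirst, ← h.commit] at hx ⊢
  obtain ⟨_, hy, hy', y, hyP, rfl⟩ :=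
    Interaction.exists_common_asked h.guessAnswer_eq _ ⟨_, hx, x, hxP, rfl⟩
  exact ⟨y, hyP, hy, hy'⟩

end VCScheme

/-! ### Hiding -/

section Hiding

variable {κ d : ℕ} {V R : Type} {encV : V → List Bool} {encR : R → List Bool}

theorem countablyMeasurable_nodeHash (v : Fin (2 ^ d) → V) (r : Fin (2 ^ d) → R) (n j : ℕ) :
    CountablyMeasurable fun H : Oracle κ => nodeHash H d (leafHashes encV encR H v r) n j := by
  simpa only [run_nodeStrategy] using
    (nodeStrategy κ encV encR v r n j).countablyMeasurable_run countablyMeasurable_eval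

theorem countablyMeasurable_openAt (v : Fin (2 ^ d) → V) (r : Fin (2 ^ d) → R)
    (i : Fin (2 ^ d)) :
    CountablyMeasurable fun H : Oracle κ => (merkleVC κ d encV encR).openAt H v r i :=
  .of_measurable (γ := Fin d → Hash κ) <| measurable_pi_lambda _ fun n s _ =>
    (countablyMeasurable_nodeHash v r n (sibling (i / 2 ^ (n : ℕ)))).measurableSet_preimage s

theorem countablyMeasurable_guessAnswer (vs : Bool → Fin (2 ^ d) → V) (b : Bool)
    (r : Fin (2 ^ d) → R) (q : List Bool ⊕ Fin (2 ^ d)) :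
    CountablyMeasurable fun H : Oracle κ => (merkleVC κ d encV encR).guessAnswer H vs b r q := by
  cases q with
  | inl x => exact countablyMeasurable_eval x
  | inr i =>
    simp only [VCScheme.guessAnswer]
    split_ifs
    · exact (countablyMeasurable_openAt (vs b) r i).comp fun w => some (r i, w)
    · exact .const none

variable (a : (merkleVC κ d encV encR).HidingStrategy) (b : Bool) (r : Fin (2 ^ d) → R)

theorem countablyMeasurable_hidingGuess :
    CountablyMeasurable fun H => (merkleVC κ d encV encR).hidingGuess H a b r :=
  (a.countablyMeasurable_run countablyMeasurable_eval).bind (g := fun p H =>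
    (p.2 ((merkleVC κ d encV encR).commit H (p.1 b) r)).run
      ((merkleVC κ d encV encR).guessAnswer H p.1 b r)) fun p =>
  (countablyMeasurable_nodeHash (p.1 b) r d 0).bind (g := fun C H =>
    (p.2 C).run ((merkleVC κ d encV encR).guessAnswer H p.1 b r)) fun C =>
  (p.2 C).countablyMeasurable_run (countablyMeasurable_guessAnswer p.1 b r)

theorem countablyMeasurable_guessAsked :
    CountablyMeasurable fun H => (merkleVC κ d encV encR).guessAsked H a b r :=
  (a.countablyMeasurable_run countablyMeasurable_eval).bind (g := fun p H =>
    (p.2 ((merkleVC κ d encV encR).commit H (p.1 b) r)).asked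
      ((merkleVC κ d encV encR).guessAnswer H p.1 b r)) fun p =>
  (countablyMeasurable_nodeHash (p.1 b) r d 0).bind (g := fun C H =>
    (p.2 C).asked ((merkleVC κ d encV encR).guessAnswer H p.1 b r)) fun C =>
  (p.2 C).countablyMeasurable_asked (countablyMeasurable_guessAnswer p.1 b r)

/-- The adversary queries the oracle for a hash of leaf `i` with salt `s`, in the first phase or
in the second phase of the game with challenge bit `b` and salts `r`. In the second phase only the
leaves at which the two vectors differ count, since the other ones may be opened. -/
def Touches (H : Oracle κ) (i : Fin (2 ^ d)) (s : R) : Prop :=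
  ∃ v, leafPoint d encV encR (i, v, s) ∈ a.asked H ∨
    (a.run H).1 false i ≠ (a.run H).1 true i ∧
      .inl (leafPoint d encV encR (i, v, s)) ∈ (merkleVC κ d encV encR).guessAsked H a b r

theorem measurableSet_touches (i : Fin (2 ^ d)) (s : R) :
    MeasurableSet {H | Touches a b r H i s} :=
  ((a.countablyMeasurable_asked countablyMeasurable_eval).prodMk
    ((a.countablyMeasurable_run countablyMeasurable_eval).prodMk
      (countablyMeasurable_guessAsked a b r))).measurableSet_preimage
    {t | ∃ v, leafPoint d encV encR (i, v, s) ∈ t.1 ∨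
      t.2.1.1 false i ≠ t.2.1.1 true i ∧ Sum.inl (leafPoint d encV encR (i, v, s)) ∈ t.2.2}

open Classical in
/-- Exchanging the two values at each leaf with its salt in use turns one challenge into the other
one. -/
theorem sameView_swap_values
    (henc : Function.Injective fun x : V × R => encV x.1 ++ encR x.2)
    (vs : Bool → Fin (2 ^ d) → V) (H : Oracle κ) :
    (merkleVC κ d encV encR).SameView vs
      {x | ∃ i v, vs false i ≠ vs true i ∧ leafPoint d encV encR (i, v, r i) = x} H
      (H ∘ leafPerm henc fun i => Equiv.swap (vs false i, r i) (vs true i, r i)) b (!b) r r := by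
  have hswap (i : Fin (2 ^ d)) :
      Equiv.swap (vs false i, r i) (vs true i, r i) (vs (!b) i, r i) = (vs b i, r i) := by
    cases b <;> simp
  refine ⟨fun x hx => congrArg H ?_, (commit_comp_leafPerm hswap).symm, fun _ _ => rfl,
    (openAt_comp_leafPerm hswap).symm⟩
  by_contra hmoved
  obtain ⟨i, z, hz, rfl⟩ := exists_leafPoint_of_leafPerm_ne (Ne.symm hmoved)
  obtain ⟨hne, rfl | rfl⟩ := Equiv.swap_apply_ne_self_iff.1 hz
  all_goals exact hx ⟨i, _, fun h => hne (by rw [h]), rfl⟩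

theorem oracleLaw_hidingGuess_le
    (henc : Function.Injective fun x : V × R => encV x.1 ++ encR x.2) (o : Bool) :
    oracleLaw κ {H | (merkleVC κ d encV encR).hidingGuess H a b r = o} ≤
      oracleLaw κ {H | (merkleVC κ d encV encR).hidingGuess H a (!b) r = o} +
        oracleLaw κ {H | ∃ i, Touches a b r H i (r i)} := by
  classical
  have huntouched : oracleLaw κ ({H | (merkleVC κ d encV encR).hidingGuess H a b r = o} \
      {H | ∃ i, Touches a b r H i (r i)}) ≤
      oracleLaw κ {H | (merkleVC κ d encV encR).hidingGuess H a (!b) r = o} := by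
    refine measure_le_of_adaptive (a.countablyMeasurable_run countablyMeasurable_eval)
      (fun p => measurePreserving_comp_perm_oracleLaw (leafPerm henc fun i =>
        Equiv.swap (p.1 false i, r i) (p.1 true i, r i))) ?_
    rintro H ⟨hguess, htouch⟩
    have hview := sameView_swap_values b r henc (a.run H).1 H
    have hfirst : ∀ x ∈ {x | ∃ i v, (a.run H).1 false i ≠ (a.run H).1 true i ∧
        leafPoint d encV encR (i, v, r i) = x}, x ∉ a.asked H := by
      rintro x ⟨i, v, -, rfl⟩ hx
      exact htouch ⟨i, v, Or.inl hx⟩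
    refine ⟨(VCScheme.run_eq_of_forall_asked hview.oracle hfirst).symm,
      (hview.hidingGuess_eq hfirst ?_).symm.trans hguess⟩
    rintro x ⟨i, v, hne, rfl⟩ hx
    exact htouch ⟨i, v, Or.inr ⟨hne, hx⟩⟩
  exact (MeasureTheory.measure_le_inter_add_sdiff ..).trans (by
    rw [add_comm]
    gcongr
    exact Set.inter_subset_right)

open Classical in
/-- The permutation of the points of the oracle that exchanges the salts `s` and `t` at leaf `i`. -/
noncomputable def saltSwap (henc : Function.Injective fun x : V × R => encV x.1 ++ encR x.2)
    (i : Fin (2 ^ d)) (s t : R) : Equiv.Perm (List Bool) :=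
  leafPerm henc (Pi.mulSingle i ((Equiv.refl V).prodCongr (Equiv.swap s t)))

theorem exists_leafPoint_of_saltSwap_ne
    {henc : Function.Injective fun x : V × R => encV x.1 ++ encR x.2} {i : Fin (2 ^ d)} {s t : R}
    {x : List Bool} (hx : saltSwap henc i s t x ≠ x) :
    ∃ v, ∃ u ∈ ({s, t} : Set R), leafPoint d encV encR (i, v, u) = x := by
  classical
  obtain ⟨j, ⟨v, u⟩, hz, rfl⟩ := exists_leafPoint_of_leafPerm_ne hx
  obtain rfl | hj := eq_or_ne j i
  · have hu : Equiv.swap s t u ≠ u := by simpa using hz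
    exact ⟨v, u, (Equiv.swap_apply_ne_self_iff.1 hu).2, rfl⟩
  · simp [hj] at hz

open Classical in
theorem sameView_saltSwap (henc : Function.Injective fun x : V × R => encV x.1 ++ encR x.2)
    {vs : Bool → Fin (2 ^ d) → V} {i : Fin (2 ^ d)} (hi : vs false i ≠ vs true i) (s : R)
    (H : Oracle κ) :
    (merkleVC κ d encV encR).SameView vs
      {x | ∃ v, ∃ u ∈ ({r i, s} : Set R), leafPoint d encV encR (i, v, u) = x} H
      (H ∘ saltSwap henc i (r i) s) b b r (Function.update r i s) := by
  have hswap (j : Fin (2 ^ d)) :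
      (Pi.mulSingle i ((Equiv.refl V).prodCongr (Equiv.swap (r i) s)) :
        Fin (2 ^ d) → Equiv.Perm (V × R)) j (vs b j, Function.update r i s j) = (vs b j, r j) := by
    obtain rfl | hj := eq_or_ne j i <;> simp [*]
  refine ⟨fun x hx => congrArg H ?_, (commit_comp_leafPerm hswap).symm, fun j hj => ?_,
    (openAt_comp_leafPerm hswap).symm⟩
  · by_contra hmoved
    exact hx (exists_leafPoint_of_saltSwap_ne (Ne.symm hmoved))
  · rw [Function.update_of_ne (by rintro rfl; exact hi hj)]

open Classical in
theorem touches_comp_saltSwap (henc : Function.Injective fun x : V × R => encV x.1 ++ encR x.2)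
    {H : Oracle κ} {i : Fin (2 ^ d)} {s : R} (h : Touches a b r H i (r i))
    (hs : ¬ Touches a b r H i s) :
    Touches a b (Function.update r i s) (H ∘ saltSwap henc i (r i) s) i (r i) := by
  set H' := H ∘ saltSwap henc i (r i) s
  let P := {x | ∃ v, ∃ u ∈ ({r i, s} : Set R), leafPoint d encV encR (i, v, u) = x}
  have horacle (x) (hx : x ∉ P) : H x = H' x := congrArg H <| by
    by_contra hmoved
    exact hx (exists_leafPoint_of_saltSwap_ne (Ne.symm hmoved))
  by_cases hfirst : ∃ x ∈ a.asked H, x ∈ P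
  · obtain ⟨_, hx, hx', v, u, rfl | rfl, rfl⟩ := a.exists_common_asked horacle hfirst
    · exact ⟨v, Or.inl hx'⟩
    · exact absurd ⟨v, Or.inl hx⟩ hs
  · have hfirst' (x) (hxP : x ∈ P) (hx : x ∈ a.asked H) : False := hfirst ⟨x, hx, hxP⟩
    obtain ⟨v, hx | ⟨hi, hx⟩⟩ := h
    · exact (hfirst' _ ⟨v, r i, Or.inl rfl, rfl⟩ hx).elim
    · obtain ⟨_, ⟨v, u, rfl | rfl, rfl⟩, hx, hx'⟩ :=
        (sameView_saltSwap b r henc hi s H).exists_common_guessAsked hfirst'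
          ⟨_, ⟨v, r i, Or.inl rfl, rfl⟩, hx⟩
      · refine ⟨v, Or.inr ⟨?_, hx'⟩⟩
        rwa [← VCScheme.run_eq_of_forall_asked horacle hfirst']
      · exact absurd ⟨v, Or.inr ⟨hi, hx⟩⟩ hs

open Classical in
/-- Unless the adversary touches the salt `s` as well, exchanging it with the salt `r i` in use
makes `r i` a salt that is not in use. -/
theorem oracleLaw_touches_le
    (henc : Function.Injective fun x : V × R => encV x.1 ++ encR x.2) (i : Fin (2 ^ d)) (s : R) :
    oracleLaw κ {H | Touches a b r H i (r i)} ≤ oracleLaw κ {H | Touches a b r H i s} +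
      oracleLaw κ {H | Touches a b (Function.update r i s) H i (r i)} := by
  refine (MeasureTheory.measure_le_inter_add_sdiff _ _ {H | Touches a b r H i s}).trans
    (add_le_add (MeasureTheory.measure_mono Set.inter_subset_right) ?_)
  calc oracleLaw κ ({H | Touches a b r H i (r i)} \ {H | Touches a b r H i s})
      ≤ oracleLaw κ ((fun H => H ∘ saltSwap henc i (r i) s) ⁻¹'
          {H | Touches a b (Function.update r i s) H i (r i)}) :=
        MeasureTheory.measure_mono fun H hH => touches_comp_saltSwap a b r henc hH.1 hH.2
    _ ≤ oracleLaw κ {H | Touches a b (Function.update r i s) H i (r i)} :=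
        (measurePreserving_comp_perm_oracleLaw _).measure_preimage_le _

end Hiding

section Averaging

open MeasureTheory

open Classical in
theorem sum_measure_le_of_card_le {Ω ι : Type*} [Fintype ι] [MeasurableSpace Ω] {μ : Measure Ω}
    [IsProbabilityMeasure μ] {A : ι → Set Ω} (hA : ∀ i, MeasurableSet (A i)) {q : ℕ}
    (hq : ∀ ω, (Finset.univ.filter fun i => ω ∈ A i).card ≤ q) : ∑ i, μ (A i) ≤ q := by
  calc ∑ i, μ (A i) = ∫⁻ ω, ∑ i, (A i).indicator 1 ω ∂μ := by
        rw [lintegral_finsetSum _ fun i _ => measurable_one.indicator (hA i)]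
        simp only [lintegral_indicator_one (hA _)]
    _ ≤ ∫⁻ _, q ∂μ := lintegral_mono fun ω => by
        simpa [Set.indicator_apply, Finset.sum_boole] using hq ω
    _ = q := by simp

theorem sum_sum_update_eq {ι R M : Type*} [Fintype ι] [DecidableEq ι] [Fintype R]
    [AddCommMonoid M] (g : (ι → R) → R → M) (i : ι) :
    ∑ r, ∑ s, g (Function.update r i s) (r i) = ∑ r, ∑ s, g r s := by
  let e : Equiv.Perm ((ι → R) × R) :=
    Function.Involutive.toPerm (fun p => (Function.update p.1 i p.2, p.1 i)) fun p => by simp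
  rw [← Fintype.sum_prod_type', ← Fintype.sum_prod_type']
  exact Equiv.sum_comp e fun p => g p.1 p.2

end Averaging

section Hiding

variable {κ d : ℕ} {V R : Type} {encV : V → List Bool} {encR : R → List Bool}

open Classical in
theorem card_filter_touches_le [Fintype R]
    (henc : Function.Injective fun x : V × R => encV x.1 ++ encR x.2)
    (a : (merkleVC κ d encV encR).HidingStrategy) (b : Bool) (r : Fin (2 ^ d) → R)
    (H : Oracle κ) :
    (Finset.univ.filter fun t : Fin (2 ^ d) × R => Touches a b r H t.1 t.2).card ≤
      (merkleVC κ d encV encR).hidingOracleQueries H a b r := by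
  let l := a.asked H ++ ((merkleVC κ d encV encR).guessAsked H a b r).filterMap Sum.getLeft?
  have hl : l.length = (merkleVC κ d encV encR).hidingOracleQueries H a b r := by
    simp only [l, VCScheme.hidingOracleQueries, List.length_append, List.length_filterMap_eq_countP]
    exact congrArg _ (List.countP_congr fun x _ => Sum.isSome_getLeft?_iff_isLeft)
  refine le_trans (Finset.card_le_card_of_forall_subsingleton
    (fun (t : Fin (2 ^ d) × R) x => ∃ v, leafPoint d encV encR (t.1, v, t.2) = x)
    (t := l.toFinset) ?_ ?_) (hl ▸ l.toFinset_card_le)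
  · rintro ⟨i, s⟩ ht
    obtain ⟨v, hv⟩ := (Finset.mem_filter.1 ht).2
    refine ⟨_, ?_, v, rfl⟩
    simp only [l, List.mem_toFinset, List.mem_append, List.mem_filterMap, Sum.getLeft?_eq_some_iff,
      exists_eq_right]
    exact hv.imp_right And.right
  · rintro x - ⟨i, s⟩ ⟨-, v, hx⟩ ⟨i', s'⟩ ⟨-, v', hx'⟩
    simpa using congrArg (fun t => (t.1, t.2.2)) (leafPoint_injective henc (hx.trans hx'.symm))

variable [Fintype R] (henc : Function.Injective fun x : V × R => encV x.1 ++ encR x.2)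
  {a : (merkleVC κ d encV encR).HidingStrategy}

include henc

theorem card_mul_sum_oracleLaw_touches_le_two_mul (b : Bool) (i : Fin (2 ^ d)) :
    (Fintype.card R : ℝ≥0∞) * ∑ r, oracleLaw κ {H | Touches a b r H i (r i)} ≤
      2 * ∑ r, ∑ s, oracleLaw κ {H | Touches a b r H i s} := by
  classical
  calc (Fintype.card R : ℝ≥0∞) * ∑ r, oracleLaw κ {H | Touches a b r H i (r i)}
      = ∑ r, ∑ _s : R, oracleLaw κ {H | Touches a b r H i (r i)} := by simp [Finset.mul_sum]
    _ ≤ ∑ r, ∑ s, (oracleLaw κ {H | Touches a b r H i s} +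
          oracleLaw κ {H | Touches a b (Function.update r i s) H i (r i)}) :=
        Finset.sum_le_sum fun r _ => Finset.sum_le_sum fun s _ => by
          convert oracleLaw_touches_le a b r henc i s
    _ = 2 * ∑ r, ∑ s, oracleLaw κ {H | Touches a b r H i s} := by
        simp only [Finset.sum_add_distrib]
        rw [sum_sum_update_eq (fun r s => oracleLaw κ {H | Touches a b r H i s}) i, two_mul]

variable {q : ℕ}
  (ha : ∀ H b r, (merkleVC κ d encV encR).hidingOracleQueries H a b r ≤ q)

include ha

theorem sum_oracleLaw_touches_le (b : Bool) (r : Fin (2 ^ d) → R) :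
    ∑ i, ∑ s, oracleLaw κ {H | Touches a b r H i s} ≤ q := by
  rw [← Fintype.sum_prod_type']
  exact sum_measure_le_of_card_le (A := fun t : Fin (2 ^ d) × R => {H | Touches a b r H t.1 t.2})
    (fun t => measurableSet_touches a b r t.1 t.2) fun H =>
    (card_filter_touches_le henc a b r H).trans (ha H b r)

theorem card_mul_sum_oracleLaw_exists_touches_le (b : Bool) :
    (Fintype.card R : ℝ≥0∞) * ∑ r, oracleLaw κ {H | ∃ i, Touches a b r H i (r i)} ≤
      2 * (q * Fintype.card (Fin (2 ^ d) → R)) := by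
  calc (Fintype.card R : ℝ≥0∞) * ∑ r, oracleLaw κ {H | ∃ i, Touches a b r H i (r i)}
      ≤ Fintype.card R * ∑ r, ∑ i, oracleLaw κ {H | Touches a b r H i (r i)} := by
        gcongr with r
        simp only [Set.ofPred_exists]
        exact MeasureTheory.measure_iUnion_fintype_le _ _
    _ = ∑ i, Fintype.card R * ∑ r, oracleLaw κ {H | Touches a b r H i (r i)} := by
        rw [Finset.sum_comm, Finset.mul_sum]
    _ ≤ ∑ i, 2 * ∑ r, ∑ s, oracleLaw κ {H | Touches a b r H i s} :=
        Finset.sum_le_sum fun i _ => card_mul_sum_oracleLaw_touches_le_two_mul henc b i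
    _ = 2 * ∑ r, ∑ i, ∑ s, oracleLaw κ {H | Touches a b r H i s} := by
        rw [← Finset.mul_sum, Finset.sum_comm]
    _ ≤ 2 * ∑ _r : Fin (2 ^ d) → R, (q : ℝ≥0∞) := by
        gcongr with r
        exact sum_oracleLaw_touches_le henc ha b r
    _ = 2 * (q * Fintype.card (Fin (2 ^ d) → R)) := by simp [mul_comm]

theorem sum_real_exists_touches_le [Nonempty R] (b : Bool) :
    ∑ r, (oracleLaw κ).real {H | ∃ i, Touches a b r H i (r i)} ≤
      2 * (q / Fintype.card R) * Fintype.card (Fin (2 ^ d) → R) := by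
  have hreal : (Fintype.card R : ℝ) * ∑ r, (oracleLaw κ).real {H | ∃ i, Touches a b r H i (r i)} ≤
      2 * (q * Fintype.card (Fin (2 ^ d) → R)) := by
    simpa [MeasureTheory.measureReal_def, ENNReal.toReal_sum] using
      ENNReal.toReal_mono (by finiteness) (card_mul_sum_oracleLaw_exists_touches_le henc ha b)
  have hcard : (0 : ℝ) < Fintype.card R := by exact_mod_cast Fintype.card_pos
  rw [mul_div_assoc', div_mul_eq_mul_div, le_div_iff₀ hcard]
  linarith

theorem sum_real_hidingGuess_le [Nonempty R] (b o : Bool) :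
    ∑ r, (oracleLaw κ).real {H | (merkleVC κ d encV encR).hidingGuess H a b r = o} ≤
      ∑ r, (oracleLaw κ).real {H | (merkleVC κ d encV encR).hidingGuess H a (!b) r = o} +
        2 * (q / Fintype.card R) * Fintype.card (Fin (2 ^ d) → R) := by
  refine (Finset.sum_le_sum fun r _ => ?_).trans
    (Finset.sum_add_distrib.trans_le (add_le_add_right (sum_real_exists_touches_le henc ha b) _))
  have hreal := ENNReal.toReal_mono (by finiteness) (oracleLaw_hidingGuess_le a b r henc o)
  rwa [ENNReal.toReal_add (by finiteness) (by finiteness)] at hreal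

end Hiding

namespace VCScheme

variable {κ L : ℕ} {V R : Type} (S : VCScheme κ L V R)

theorem hidingProb_eq_tsum [Fintype R] [Nonempty R] (A : PMF S.HidingStrategy) :
    S.hidingProb A = ∑' a, (A a).toReal * ((∑ b, (∑ r,
      (oracleLaw κ).real {H | S.hidingGuess H a b r = b}) / Fintype.card (Fin L → R)) / 2) := by
  simp only [hidingProb, romProb_bind A, romProb_uniformOfFintype_bind, romProb_pure,
    Fintype.card_bool, Nat.cast_ofNat]

theorem hidingOracleQueries_le_hidingQueries (H : Oracle κ) (a : S.HidingStrategy) (b : Bool)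
    (r : Fin L → R) : S.hidingOracleQueries H a b r ≤ S.hidingQueries H a b r :=
  Nat.add_le_add_left List.countP_le_length _

end VCScheme

section Hiding

variable {κ d : ℕ} {V R : Type} [Fintype R] {encV : V → List Bool}
  {encR : R → List Bool}

theorem sum_real_hidingGuess_true_add_false (a : (merkleVC κ d encV encR).HidingStrategy)
    (b : Bool) :
    ∑ r, (oracleLaw κ).real {H | (merkleVC κ d encV encR).hidingGuess H a b r = true} +
      ∑ r, (oracleLaw κ).real {H | (merkleVC κ d encV encR).hidingGuess H a b r = false} =
        Fintype.card (Fin (2 ^ d) → R) := by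
  have hadd (r : Fin (2 ^ d) → R) :
      (oracleLaw κ).real {H | (merkleVC κ d encV encR).hidingGuess H a b r = true} +
        (oracleLaw κ).real {H | (merkleVC κ d encV encR).hidingGuess H a b r = false} = 1 := by
    have hcompl : {H : Oracle κ | (merkleVC κ d encV encR).hidingGuess H a b r = false} =
        {H | (merkleVC κ d encV encR).hidingGuess H a b r = true}ᶜ := by
      ext H
      simp
    rw [hcompl]
    exact MeasureTheory.probReal_add_probReal_compl
      ((countablyMeasurable_hidingGuess a b r).measurableSet_preimage {true})
  simp only [← Finset.sum_add_distrib, hadd, Finset.sum_const, Finset.card_univ, nsmul_eq_mul,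
    mul_one]

variable [Nonempty R]

theorem merkleVC_hidingProb_close
    (henc : Function.Injective fun x : V × R => encV x.1 ++ encR x.2)
    (hR : 2 ^ κ ≤ Fintype.card R) (q : ℕ) (A : PMF (merkleVC κ d encV encR).HidingStrategy)
    (hA : ∀ a ∈ A.support, ∀ (H : Oracle κ) (b : Bool) (r : Fin (2 ^ d) → R),
      (merkleVC κ d encV encR).hidingOracleQueries H a b r ≤ q) :
    |(merkleVC κ d encV encR).hidingProb A - 1 / 2| ≤ (q : ℝ) / 2 ^ κ := by
  suffices hcard : |(merkleVC κ d encV encR).hidingProb A - 1 / 2| ≤ (q : ℝ) / Fintype.card R from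
    hcard.trans (by gcongr; exact_mod_cast hR)
  rw [VCScheme.hidingProb_eq_tsum, abs_sub_le_iff, sub_le_iff_le_add', sub_le_comm, and_comm]
  refine tsum_toReal_mul_mem_Icc A fun a ha => ?_
  have htrue := sum_real_hidingGuess_le henc (hA a ha) true true
  have hfalse := sum_real_hidingGuess_le henc (hA a ha) false true
  have htotal := sum_real_hidingGuess_true_add_false a false
  have : (0 : ℝ) < Fintype.card (Fin (2 ^ d) → R) := by exact_mod_cast Fintype.card_pos
  rw [Fintype.sum_bool, ← add_div, div_div, Set.mem_Icc, le_div_iff₀ (by positivity),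
    div_le_iff₀ (by positivity)]
  simp only [Bool.not_true, Bool.not_false] at htrue hfalse
  constructor <;> linarith

end Hiding

end SaltedMerkle

theorem mainTheorem2_general (d : ℕ) (V R : ℕ → Type)
    [∀ κ, Fintype (R κ)] [∀ κ, Nonempty (R κ)]
    (hR : ∀ κ, 2 ^ κ ≤ Fintype.card (R κ))
    (encV : ∀ κ, V κ → List Bool) (encR : ∀ κ, R κ → List Bool)
    (henc : ∀ κ, Function.Injective fun x : V κ × R κ => encV κ x.1 ++ encR κ x.2) :
    SaltedMerkle.IsGoodVC (fun κ => SaltedMerkle.merkleVC κ d (encV κ) (encR κ)) ∧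
    (∀ (κ q : ℕ)
      (A : PMF (SaltedMerkle.merkleVC κ d (encV κ) (encR κ)).BindingStrategy),
      (∀ a ∈ A.support, ∀ H : SaltedMerkle.Oracle κ, (a.asked H).length ≤ q) →
      (SaltedMerkle.merkleVC κ d (encV κ) (encR κ)).bindingProb A
        ≤ ((q : ℝ) + 2 * (2 ^ (d + 1) - 1)) ^ 2 / 2 ^ κ) ∧
    (∀ (κ q : ℕ)
      (A : PMF (SaltedMerkle.merkleVC κ d (encV κ) (encR κ)).PositionStrategy),
      (∀ a ∈ A.support, ∀ H : SaltedMerkle.Oracle κ, (a.asked H).length ≤ q) →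
      (SaltedMerkle.merkleVC κ d (encV κ) (encR κ)).positionProb A
        ≤ ((q : ℝ) + 2 * (d + 1)) ^ 2 / 2 ^ κ) ∧
    (∀ (κ q : ℕ)
      (A : PMF (SaltedMerkle.merkleVC κ d (encV κ) (encR κ)).HidingStrategy),
      (∀ a ∈ A.support, ∀ (H : SaltedMerkle.Oracle κ) (b : Bool) (r : Fin (2 ^ d) → R κ),
        (SaltedMerkle.merkleVC κ d (encV κ) (encR κ)).hidingOracleQueries H a b r ≤ q) →
      |(SaltedMerkle.merkleVC κ d (encV κ) (encR κ)).hidingProb A - 1 / 2|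
        ≤ (q : ℝ) / 2 ^ κ) := by
  have hbinding := fun κ => SaltedMerkle.merkleVC_bindingProb_le (κ := κ) (d := d) (henc κ)
  have hposition := fun κ => SaltedMerkle.merkleVC_positionProb_le (κ := κ) (d := d) (henc κ)
  have hhiding := fun κ => SaltedMerkle.merkleVC_hidingProb_close (d := d) (henc κ) (hR κ)
  refine ⟨⟨fun κ => SaltedMerkle.merkleVC_correct, ?_, ?_, ?_⟩, hbinding, hposition, hhiding⟩
  · rintro A ⟨p, hp⟩
    refine SaltedMerkle.negligible_of_le_polynomial_eval_div_two_pow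
      ((.X + .C (2 * (2 ^ (d + 1) - 1))) ^ 2) p fun κ => ?_
    simpa using hbinding κ _ (A κ) (hp κ)
  · rintro A ⟨p, hp⟩
    refine SaltedMerkle.negligible_of_le_polynomial_eval_div_two_pow
      ((.X + .C (2 * ((d : ℝ) + 1))) ^ 2) p fun κ => ?_
    simpa using hposition κ _ (A κ) (hp κ)
  · rintro A ⟨p, hp⟩
    refine SaltedMerkle.negligible_of_le_polynomial_eval_div_two_pow .X p fun κ => ?_
    simpa using hhiding κ _ (A κ) fun a ha H b r =>
      (SaltedMerkle.VCScheme.hidingOracleQueries_le_hidingQueries _ H a b r).trans (hp κ a ha H b r)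

theorem mainTheorem2 (d : ℕ) (V R : ℕ → Type)
    [∀ κ, Finite (V κ)] [∀ κ, Fintype (R κ)] [∀ κ, Nonempty (R κ)]
    (hR : ∀ κ, 2 ^ κ ≤ Fintype.card (R κ))
    (encV : ∀ κ, V κ → List Bool) (encR : ∀ κ, R κ → List Bool)
    (henc : ∀ κ, Function.Injective fun x : V κ × R κ => encV κ x.1 ++ encR κ x.2) :
    SaltedMerkle.IsGoodVC (fun κ => SaltedMerkle.merkleVC κ d (encV κ) (encR κ)) ∧
    (∀ (κ q : ℕ)
      (A : PMF (SaltedMerkle.merkleVC κ d (encV κ) (encR κ)).BindingStrategy),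
      (∀ a ∈ A.support, ∀ H : SaltedMerkle.Oracle κ, (a.asked H).length ≤ q) →
      (SaltedMerkle.merkleVC κ d (encV κ) (encR κ)).bindingProb A
        ≤ ((q : ℝ) + 2 * (2 ^ (d + 1) - 1)) ^ 2 / 2 ^ κ) ∧
    (∀ (κ q : ℕ)
      (A : PMF (SaltedMerkle.merkleVC κ d (encV κ) (encR κ)).PositionStrategy),
      (∀ a ∈ A.support, ∀ H : SaltedMerkle.Oracle κ, (a.asked H).length ≤ q) →
      (SaltedMerkle.merkleVC κ d (encV κ) (encR κ)).positionProb A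
        ≤ ((q : ℝ) + 2 * (d + 1)) ^ 2 / 2 ^ κ) ∧
    (∀ (κ q : ℕ)
      (A : PMF (SaltedMerkle.merkleVC κ d (encV κ) (encR κ)).HidingStrategy),
      (∀ a ∈ A.support, ∀ (H : SaltedMerkle.Oracle κ) (b : Bool) (r : Fin (2 ^ d) → R κ),
        (SaltedMerkle.merkleVC κ d (encV κ) (encR κ)).hidingOracleQueries H a b r ≤ q) →
      |(SaltedMerkle.merkleVC κ d (encV κ) (encR κ)).hidingProb A - 1 / 2|
        ≤ (q : ℝ) / 2 ^ κ) :=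
  mainTheorem2_general d V R hR encV encR henc
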